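/- **Lemma (Approximation of stationary distribution).** *Setting.* Let $n\ge 1$ players have finite non-empty action sets $\mathcal A_1,\dots,\mathcal A_n$, let $\mathcal A=\prod_i\mathcal A_i$, and let $u_i:\mathcal A\to\mathbb R$ be utility functions. Fix constants $\epsilon,h,c,\nu>0$ with $\epsilon\nu<1$ and put $\phi(x,y)=x$ if $y\ge 0$, $\phi(x,y)=\max\{h,x+cy\}$ if $y<0$. A state is $z=(\alpha,x,\rho,\upsilon)$ with an action profile $\alpha\in\mathcal A$, mixed strategies $x_i\in\Delta(|\mathcal A_i|)$, aspiration levels $\rho\in\mathbb R^n$ and a noise value $\upsilon\in\mathbb R^n$. Let $N$ be a probability law on $\mathbb R^n$. If in state $z$ the profile $\alpha^+$ is played and the noise $\upsilon^+$ is realized, then, with $\tilde u_i=u_i(\alpha^+)+\upsilon^+_i$, the next state is $(\alpha^+,x^+,\rho^+,\upsilon^+)$, where $$x_i^+=x_i+\epsilon\,(e_{\alpha_i^+}-x_i)\,\phi(\tilde u_i,\tilde u_i-\rho_i),\qquad \rho_i^+=\rho_i+\epsilon\nu\,(\tilde u_i-\rho_i).$$ Under the transition function $P$ (unperturbed process)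 the $\alpha_i^+$ are drawn independently from the $x_i$, and $\upsilon^+$ is drawn from $N$ independently of them. Under $Q$ one player, chosen uniformly at random, instead draws its action uniformly from its action set. $\mathbb P_z$ is the law of the unperturbed process started at $z$. Each $\alpha\in\mathcal A$ has the pure strategy state $s$ with $x_i=e_{\alpha_i}$, $\rho_i=u_i(\alpha)$ (the noise entry is irrelevant); $\mathcal S$ is the set of these states. Fix $p\in[1,\infty]$ and let $|\cdot|$ be the $\ell^p$-norm (both on strategy profiles and on $\mathbb R^n$). For $s=(\alpha,x,\rho)\in\mathcal S$ let $\mathcal N_\delta(s)$ be the set of states $(\alpha',x',\rho',\cdot)$ with $\alpha'=\alpha$, $|x-x'|<\delta$, $|\rho-\rho'|<\delta$. Define $$\hat P_{ss'}(\delta)=\lim_{t\to\infty}QP^t(s,\mathcal N_\delta(s')),\qquad \breve P_{ss'}(\delta)=\mathbb P_{z'}\big[\exists\,t\ge 0:\ Z_t\in\mathcal N_\delta(s')\big],$$ where $z'$ is the (noise dependent, hence random) state that follows $s$ when the profile of $s'$ is played; the probability $\breve P_{ss'}$ also averages over the noise in this step. An $\{s\}$-graph is a set of arrows $s_k\to s_\ell$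 with $s_k\in\mathcal S\setminus\{s\}$, $s_\ell\in\mathcal S$, $s_\ell\ne s_k$, such that each $s_k\neq s$ is the initial point of exactly one arrow and there are no closed cycles. $\mathcal G^{(1)}\{s\}$ is the set of $\{s\}$-graphs all of whose arrows join states whose action profiles differ in the action of exactly one player. *Noise.* For every $\delta>0$ let the noise law $N=N_\delta$ satisfy $|\upsilon|\le\overline\upsilon(\delta)$ almost surely, where $\overline\upsilon(\delta)<\delta$. (For $p=\infty$ this says $\upsilon_i\in[-\overline\upsilon(\delta),\overline\upsilon(\delta)]$ for all $i$; for $p=2$ the norms are Euclidean.) Assume that for all sufficiently small $\delta>0$, almost surely under $N_\delta$, $0<\epsilon\,(u_i(\alpha)+\upsilon_i)<1$ and $h<u_i(\alpha)+\upsilon_i$ for all $i$ and $\alpha$. *Claim.* There are constants $\bar\gamma_g\in(0,1)$, one for each graph $g\in\bigcup_s\mathcal G^{(1)}\{s\}$, which depend only on $g$ and the action sets (not on $u,\epsilon,h,c,\nu,p,\delta$ or the noise), such that the following holds. For all sufficiently small $\delta>0$ the limits that define $\hat P(\delta)$ exist, $\hat P(\delta)$ is a stochastic matrix, and it has a unique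 stationary distribution $\hat\pi(\delta)$. With $$\breve R_s(\delta)=\sum_{g\in\mathcal G^{(1)}\{s\}}\bar\gamma_g\prod_{(s_k\to s_\ell)\in g}\breve P_{s_ks_\ell}(\delta),\qquad \breve\pi_s(\delta)=\frac{\breve R_s(\delta)}{\sum_{s_i\in\mathcal S}\breve R_{s_i}(\delta)},$$ both limits below exist and $$\lim_{\delta\downarrow0}\hat\pi_s(\delta)=\lim_{\delta\downarrow0}\breve\pi_s(\delta)\qquad\text{for every } s\in\mathcal S.$$ -/

import Mathlib

open MeasureTheory ProbabilityTheory Filter Topology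
open scoped ENNReal

noncomputable section

namespace APLA

/-- Action profiles of `n` players with action sets `A 0, …, A (n - 1)`. -/
abbrev Profile {n : ℕ} (A : Fin n → Type*) : Type _ := ∀ i, A i

/-- Game and design parameters: the nominal utilities `u`, the step size `ε`, the constants `h`, `c`
of the aspiration factor, and `ν`, the value at `ε` of the aspiration step-size factor (the
aspiration level is updated with step size `ε * ν`). -/
structure Params {n : ℕ} (A : Fin n → Type*) where
  u : Fin n → Profile A → ℝ
  ε : ℝ
  h : ℝ
  c : ℝ
  ν : ℝ

/-- States `z = (α, x, ρ, υ)`: action profile, strategy profile, aspiration-level profile and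
realization of the measurement noise. -/
abbrev State {n : ℕ} (A : Fin n → Type*) [∀ i, Fintype (A i)] : Type _ :=
  Profile A × (∀ i, stdSimplex ℝ (A i)) × (Fin n → ℝ) × (Fin n → ℝ)

/-- The aspiration factor `φ(x, y)`. -/
def aspirationFactor (h c x y : ℝ) : ℝ := if 0 ≤ y then x else max h (x + c * y)

/-- The vertex `e_a` of the simplex. -/
def vertex {B : Type*} [Fintype B] [DecidableEq B] (a : B) : stdSimplex ℝ B :=
  ⟨Pi.single a 1, single_mem_stdSimplex ℝ a⟩

/-- The strategy update `x + θ (e_a - x)`. The step `θ` is truncated to `[0, 1]`, so that the new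
strategy lies in the simplex for every real `θ`; the truncation is inactive for `θ ∈ [0, 1]`, see
`coe_reinforce`. -/
def reinforce {B : Type*} [Fintype B] [DecidableEq B] (x : stdSimplex ℝ B) (a : B) (θ : ℝ) :
    stdSimplex ℝ B :=
  ⟨fun b => x.1 b + max 0 (min θ 1) * ((Pi.single a 1 : B → ℝ) b - x.1 b), by
    have h0 : (0 : ℝ) ≤ max 0 (min θ 1) := le_max_left _ _
    have h1 : max 0 (min θ 1) ≤ (1 : ℝ) := max_le zero_le_one (min_le_right _ _)
    have hx := x.2
    have he := single_mem_stdSimplex ℝ a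
    have key := convex_stdSimplex ℝ B hx he (sub_nonneg.2 h1) h0 (sub_add_cancel _ _)
    convert key using 1
    funext b
    simp only [Pi.add_apply, Pi.smul_apply, smul_eq_mul]
    ring⟩

lemma coe_reinforce {B : Type*} [Fintype B] [DecidableEq B] (x : stdSimplex ℝ B) (a : B) {θ : ℝ}
    (h0 : 0 ≤ θ) (h1 : θ ≤ 1) :
    (reinforce x a θ).1 = x.1 + θ • ((Pi.single a 1 : B → ℝ) - x.1) := by
  funext b
  simp [reinforce, min_eq_left h1, max_eq_right h0]

section Dynamics

variable {n : ℕ} {A : Fin n → Type*} [∀ i, Fintype (A i)] [∀ i, DecidableEq (A i)]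

/-- The measured utility `ũ_i(α) = u_i(α) + υ_i`. -/
def measuredUtility (G : Params A) (α : Profile A) (υ : Fin n → ℝ) (i : Fin n) : ℝ :=
  G.u i α + υ i

/-- The state that follows `z` when the profile `α` is played and the noise `υ` is realized. -/
def next (G : Params A) (z : State A) (α : Profile A) (υ : Fin n → ℝ) : State A :=
  (α,
   fun i => reinforce (z.2.1 i) (α i)
     (G.ε * aspirationFactor G.h G.c (measuredUtility G α υ i)
       (measuredUtility G α υ i - z.2.2.1 i)),
   fun i => z.2.2.1 i + G.ε * G.ν * (measuredUtility G α υ i - z.2.2.1 i),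
   υ)

/-- Probability that `α` is played next from `z` when no player trembles. -/
def playProb (z : State A) (α : Profile A) : ℝ := ∏ i, (z.2.1 i).1 (α i)

/-- Probability that `α` is played next from `z` when exactly one player, chosen uniformly at
random, trembles, that is, selects its action uniformly at random. -/
def trembleProb (z : State A) (α : Profile A) : ℝ :=
  ∑ j, (1 / (n : ℝ)) * ∏ i, if i = j then 1 / (Fintype.card (A i) : ℝ) else (z.2.1 i).1 (α i)

variable [∀ i, MeasurableSpace (A i)] [∀ i, MeasurableSingletonClass (A i)]

lemma measurable_next (G : Params A) (α : Profile A) :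
    Measurable fun q : State A × (Fin n → ℝ) => next G q.1 α q.2 := by
  have hU : ∀ i, Measurable fun q : State A × (Fin n → ℝ) => measuredUtility G α q.2 i :=
    fun i => by unfold measuredUtility; fun_prop
  have hρ : ∀ i, Measurable fun q : State A × (Fin n → ℝ) => q.1.2.2.1 i := fun i => by fun_prop
  have hφ : ∀ i, Measurable fun q : State A × (Fin n → ℝ) =>
      aspirationFactor G.h G.c (measuredUtility G α q.2 i)
        (measuredUtility G α q.2 i - q.1.2.2.1 i) := fun i => by
    unfold aspirationFactor
    have h1 := hU i
    have h2 := hρ i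
    exact Measurable.ite (measurableSet_le measurable_const (h1.sub h2)) h1
      (measurable_const.max (h1.add ((h1.sub h2).const_mul _)))
  refine measurable_const.prodMk (Measurable.prodMk ?_ (Measurable.prodMk ?_ measurable_snd))
  · refine measurable_pi_lambda _ fun i => Measurable.subtype_mk ?_
    refine measurable_pi_lambda _ fun b => ?_
    have hx : Measurable fun q : State A × (Fin n → ℝ) => (q.1.2.1 i).1 b := by
      have : Measurable fun q : State A × (Fin n → ℝ) => (q.1.2.1 i).1 :=
        measurable_subtype_coe.comp (by fun_prop)
      exact (measurable_pi_apply b).comp this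
    exact hx.add ((measurable_const.max (((hφ i).const_mul _).min measurable_const)).mul
      (measurable_const.sub hx))
  · refine measurable_pi_lambda _ fun i => ?_
    exact (hρ i).add (((hU i).sub (hρ i)).const_mul _)

lemma measurable_coord (i : Fin n) (a : A i) :
    Measurable fun z : State A => (z.2.1 i).1 a :=
  (measurable_pi_apply a).comp (measurable_subtype_coe.comp (by fun_prop))

lemma measurable_playProb (α : Profile A) : Measurable fun z : State A => playProb z α :=
  Finset.measurable_prod _ fun i _ => measurable_coord i (α i)

lemma measurable_trembleProb (α : Profile A) : Measurable fun z : State A => trembleProb z α := by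
  refine Finset.measurable_sum _ fun j _ => Measurable.const_mul ?_ _
  refine Finset.measurable_prod _ fun i _ => ?_
  by_cases h : i = j
  · simp [h]
  · simpa [h] using measurable_coord i (α i)

/-- One step of the dynamics: the profile `α` is played with probability `w z α`, the noise is drawn
from the law `N` independently of it, and the state is updated. -/
def stepKernel (G : Params A) (N : Measure (Fin n → ℝ)) [SFinite N] (w : State A → Profile A → ℝ)
    (hw : ∀ α, Measurable fun z => w z α) : Kernel (State A) (State A) where
  toFun z := ∑ α : Profile A, ENNReal.ofReal (w z α) • N.map (fun υ => next G z α υ)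
  measurable' := by
    refine Measure.measurable_of_measurable_coe _ fun s hs => ?_
    simp only [Measure.finsetSum_apply, Measure.smul_apply, smul_eq_mul]
    refine Finset.measurable_sum _ fun α _ => (hw α).ennreal_ofReal.mul ?_
    have hm := measurable_next G α
    have : ∀ z : State A, N.map (fun υ => next G z α υ) s
        = N (Prod.mk z ⁻¹' ((fun q : State A × (Fin n → ℝ) => next G q.1 α q.2) ⁻¹' s)) := fun z =>
      Measure.map_apply (hm.comp measurable_prodMk_left) hs
    simp only [this]
    exact measurable_measure_prodMk_left (hm hs)

lemma isMarkovKernel_stepKernel (G : Params A) (N : Measure (Fin n → ℝ)) [IsProbabilityMeasure N]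
    (w : State A → Profile A → ℝ) (hw : ∀ α, Measurable fun z => w z α)
    (h0 : ∀ z α, 0 ≤ w z α) (h1 : ∀ z, ∑ α, w z α = 1) :
    IsMarkovKernel (stepKernel G N w hw) := by
  refine ⟨fun z => ⟨?_⟩⟩
  change (∑ α : Profile A, ENNReal.ofReal (w z α) • N.map (fun υ => next G z α υ)) Set.univ = 1
  have hm : ∀ α, Measurable fun υ => next G z α υ := fun α =>
    (measurable_next G α).comp measurable_prodMk_left
  simp only [Measure.finsetSum_apply, Measure.smul_apply, smul_eq_mul,
    Measure.map_apply (hm _) MeasurableSet.univ, Set.preimage_univ, measure_univ, mul_one]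
  rw [← ENNReal.ofReal_sum_of_nonneg fun α _ => h0 z α, h1 z, ENNReal.ofReal_one]

/-- The transition probability function `P` of the unperturbed process. -/
def unperturbed (G : Params A) (N : Measure (Fin n → ℝ)) [SFinite N] : Kernel (State A) (State A) :=
  stepKernel G N playProb measurable_playProb

/-- The transition probability function `Q`, under which exactly one player trembles. -/
def oneTremble (G : Params A) (N : Measure (Fin n → ℝ)) [SFinite N] : Kernel (State A) (State A) :=
  stepKernel G N trembleProb measurable_trembleProb

instance (G : Params A) (N : Measure (Fin n → ℝ)) [IsProbabilityMeasure N] :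
    IsMarkovKernel (unperturbed G N) := by
  refine isMarkovKernel_stepKernel G N _ _ (fun z α => Finset.prod_nonneg fun i _ => (z.2.1 i).2.1 _)
    fun z => ?_
  have := (Finset.prod_univ_sum (fun i : Fin n => (Finset.univ : Finset (A i)))
    fun i a => (z.2.1 i).1 a).symm
  rw [Fintype.piFinset_univ] at this
  unfold playProb
  rw [this]
  exact Finset.prod_eq_one fun i _ => (z.2.1 i).2.2

/-- The law `ℙ_z` on the path space of the unperturbed process started at `z`. -/
def pathLaw (G : Params A) (N : Measure (Fin n → ℝ)) [IsProbabilityMeasure N] (z : State A) :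
    Measure (ℕ → State A) :=
  Kernel.traj (X := fun _ => State A)
    (fun t => (unperturbed G N).comap
      (fun ω : (i : Finset.Iic t) → State A => ω ⟨t, Finset.mem_Iic.2 le_rfl⟩)
      (measurable_pi_apply _)) 0 (fun _ => z)

/-- The pure strategy state of the profile `α`. Pure strategy states leave the noise entry
unspecified; the transition functions do not depend on it, and it is set to `0` here. -/
def pureState (G : Params A) (α : Profile A) : State A :=
  (α, fun i => vertex (α i), fun i => G.u i α, 0)

/-- The `δ`-neighborhood of the pure strategy state of `α`, where distances of strategy profiles and
of aspiration-level profiles are measured in the `ℓ^p` norm (`p = 2`: Euclidean norm). -/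
def nhd (p : ℝ≥0∞) [Fact (1 ≤ p)] (G : Params A) (δ : ℝ) (α : Profile A) : Set (State A) :=
  {z | z.1 = α ∧
    ‖(WithLp.toLp p fun i => WithLp.toLp p ((z.2.1 i).1 - (vertex (α i)).1) :
      PiLp p fun i => PiLp p fun _ : A i => ℝ)‖ < δ ∧
    ‖(WithLp.toLp p (fun i => z.2.2.1 i - G.u i α) : PiLp p fun _ : Fin n => ℝ)‖ < δ}

/-- The transition matrix `P̂`, with entries `lim_{t → ∞} Q P^t (s, nhd δ s')`. -/
def limitChain (p : ℝ≥0∞) [Fact (1 ≤ p)] (G : Params A) (N : Measure (Fin n → ℝ))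
    [IsProbabilityMeasure N] (δ : ℝ) : Matrix (Profile A) (Profile A) ℝ :=
  fun α β => limUnder atTop fun t : ℕ =>
    (((unperturbed G N ^ t) ∘ₖ oneTremble G N) (pureState G α) (nhd p G δ β)).toReal

/-- The one-step hitting probability from the pure strategy state of `α` to that of `β`: the
probability that the unperturbed process ever enters `nhd δ β`, when it is started at the (noise
dependent) state in which the first trembling out of the pure strategy state of `α` results, when
`β` is played. -/
def hitProb (p : ℝ≥0∞) [Fact (1 ≤ p)] (G : Params A) (N : Measure (Fin n → ℝ))
    [IsProbabilityMeasure N] (δ : ℝ) (α β : Profile A) : ℝ :=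
  (∫⁻ υ, pathLaw G N (next G (pureState G α) β υ) {ω | ∃ t, ω t ∈ nhd p G δ β} ∂N).toReal

end Dynamics

section Graphs

/-- `W`-graphs on `V`, as finite sets of arrows: arrows start outside `W` and do not join a point to
itself, every point outside `W` is the initial point of exactly one arrow, and there are no closed
cycles. -/
structure IsWGraph {V : Type*} (W : Set V) (g : Finset (V × V)) : Prop where
  source_notMem : ∀ e ∈ g, e.1 ∉ W
  ne : ∀ e ∈ g, e.2 ≠ e.1
  existsUnique : ∀ a, a ∉ W → ∃! b, (a, b) ∈ g
  acyclic : ∀ a, ¬ Relation.TransGen (fun b b' => (b, b') ∈ g) a a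

variable {n : ℕ} {A : Fin n → Type*}

/-- The two profiles differ in the action of exactly one player. -/
def OneStep (α β : Profile A) : Prop := ∃! j, α j ≠ β j

open Classical in
/-- The set `𝒢⁽¹⁾{s}` of `{s}`-graphs on the pure strategy states (indexed by action profiles) that
consist of one-step transitions only. -/
def oneStepGraphs [∀ i, Fintype (A i)] (s : Profile A) : Finset (Finset (Profile A × Profile A)) :=
  Finset.univ.filter fun g => IsWGraph {s} g ∧ ∀ e ∈ g, OneStep e.1 e.2

variable [∀ i, Fintype (A i)] [∀ i, DecidableEq (A i)]
  [∀ i, MeasurableSpace (A i)] [∀ i, MeasurableSingletonClass (A i)]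

/-- The weight `R̆_s`: sum over the one-step `{s}`-graphs `g` of the constant `γ g` times the product
of the hitting probabilities along the arrows of `g`. -/
def graphSum (γ : Finset (Profile A × Profile A) → ℝ) (p : ℝ≥0∞) [Fact (1 ≤ p)] (G : Params A)
    (N : Measure (Fin n → ℝ)) [IsProbabilityMeasure N] (δ : ℝ) (s : Profile A) : ℝ :=
  ∑ g ∈ oneStepGraphs s, γ g * ∏ e ∈ g, hitProb p G N δ e.1 e.2

/-- The distribution `π̆`. -/
def graphDistribution (γ : Finset (Profile A × Profile A) → ℝ) (p : ℝ≥0∞) [Fact (1 ≤ p)]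
    (G : Params A) (N : Measure (Fin n → ℝ)) [IsProbabilityMeasure N] (δ : ℝ) (s : Profile A) : ℝ :=
  graphSum γ p G N δ s / ∑ s', graphSum γ p G N δ s'

end Graphs

/-- `π` is a stationary distribution of the finite chain with transition matrix `M`. -/
def IsStationary {V : Type*} [Fintype V] (M : Matrix V V ℝ) (π : V → ℝ) : Prop :=
  π ∈ stdSimplex ℝ V ∧ Matrix.vecMul π M = π

end APLA

end

set_option linter.unusedSectionVars false

noncomputable section

namespace APLA

/-! ### Spanning trees of a finite chain and the Markov chain tree theorem. -/

section Trees

variable {V : Type*}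

/-! A single tremble from the pure state of `α` either plays `α` again, or plays a profile `β` that
differs from `α` in the action of one player `j`. In the second case only `j` mixes from then on,
and only between `α j` and `β j`: the process lives on an edge of the strategy space, parametrized
by the probability `x` of `β j`. Everything rests on a submartingale on this edge. Reinforcement
steps are at least `η = ε h`, so for `(k + 1) η ≥ 1` both `x ^ (k + 2)` and `(1 - x) ^ (k + 2)` are
submartingales (`pow_add_le_mul_pow`, `coordPow_add_le_expect`), and the expectation of their sum
approaches 1 at a geometric rate that depends only on `η` and `k` (`one_sub_rate_pow_le`). Hence the
two expectations converge to `q` and `1 - q`, where `q` is the probability of absorption at `β`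
(`absorbProb`).

Three consequences follow. The same power bounds from below the probability of playing `β` forever,
so the probabilities of being in the two neighborhoods also tend to `q` and `1 - q`
(`tendsto_startMean_nhd`); this identifies the limit chain with the explicit matrix `absorbMatrix`
(`limitChain_eq`). The maximal inequality for the submartingale gives `q ≤ hitProb ≤ q / (1 - δ) ^
(k + 2)`, so hitting and absorption probabilities have the same limit as `δ` tends to 0
(`tendsto_hitProb`). Finally, as the rate does not depend on the noise and finite-horizon
expectations are continuous at zero noise, `q` converges to its noiseless value
(`tendsto_edgeProb`).

By the tree theorem (`vecMul_treeWeight`) the stationary distribution of `absorbMatrix` is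
proportional to a sum over rooted trees. Only trees made of one-step arrows have non-zero weight,
and each weight splits into a product of tremble probabilities, which yields the constants, and a
product of the `q` along the arrows (`treeWeight_absorbMatrix`). Since `q` is positive on one-step
transitions, also for zero noise, the normalizing sums stay away from 0 and both distributions
converge to the same quotient. -/

lemma exists_iterate_eq_of_eq_off {f g : V → V} {b : V} (hfg : ∀ v, v ≠ b → f v = g v) (v : V)
    (h : ∃ k, f^[k] v = b) : ∃ k, g^[k] v = b := by
  obtain ⟨k, hk⟩ := h
  induction k generalizing v with
  | zero => exact ⟨0, hk⟩
  | succ k ih =>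
    by_cases hv : v = b
    · exact ⟨0, hv⟩
    · rw [Function.iterate_succ_apply, hfg v hv] at hk
      obtain ⟨m, hm⟩ := ih _ hk
      exact ⟨m + 1, by rwa [Function.iterate_succ_apply]⟩

variable [Fintype V] [DecidableEq V]

open Classical in
/-- Maps under which every point eventually reaches `b`. -/
def attractedMaps (b : V) : Finset (V → V) := Finset.univ.filter fun f => ∀ v, ∃ k, f^[k] v = b

open Classical in
/-- Maps fixing `s` under which every point eventually reaches `s`: spanning trees rooted at `s`. -/
def rootedMaps (s : V) : Finset (V → V) :=
  Finset.univ.filter fun f => f s = s ∧ ∀ v, ∃ k, f^[k] v = s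

/-- The sum over the spanning trees rooted at `s` of the product of the weights of the arrows. -/
def treeWeight (M : V → V → ℝ) (s : V) : ℝ :=
  ∑ f ∈ rootedMaps s, ∏ v ∈ Finset.univ.erase s, M v (f v)

lemma prod_update_eq (M : V → V → ℝ) (f : V → V) (a b : V) :
    ∏ v, M v (Function.update f a b v) = (∏ v ∈ Finset.univ.erase a, M v (f v)) * M a b := by
  rw [← Finset.prod_erase_mul _ _ (Finset.mem_univ a), Function.update_self]
  congr 1
  refine Finset.prod_congr rfl fun v hv => ?_
  rw [Function.update_of_ne (Finset.ne_of_mem_erase hv)]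

/-- A map attracted to `b` is a tree rooted at `b` together with a free choice of the arrow leaving
`b`. Trees are encoded with a loop at the root, which carries no weight. -/
lemma sum_attractedMaps_eq (M : V → V → ℝ) (b : V) :
    ∑ f ∈ attractedMaps b, ∏ v, M v (f v) = treeWeight M b * ∑ a, M b a := by
  rw [treeWeight, Finset.sum_mul_sum, ← Finset.sum_product']
  symm
  refine Finset.sum_nbij' (fun q => Function.update q.1 b q.2)
    (fun f => (Function.update f b b, f b)) ?_ ?_ ?_ ?_ ?_
  · rintro ⟨f, a⟩ hf
    simp only [rootedMaps, attractedMaps, Finset.mem_product, Finset.mem_filter, Finset.mem_univ,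
      true_and, and_true] at hf ⊢
    exact fun v => exists_iterate_eq_of_eq_off
      (fun w hw => (Function.update_of_ne hw _ _).symm) v (hf.2 v)
  · intro f hf
    simp only [rootedMaps, attractedMaps, Finset.mem_product, Finset.mem_filter, Finset.mem_univ,
      true_and, and_true, Function.update_self] at hf ⊢
    exact fun v => exists_iterate_eq_of_eq_off
      (fun w hw => (Function.update_of_ne hw _ _).symm) v (hf v)
  · rintro ⟨f, a⟩ hf
    simp only [rootedMaps, Finset.mem_product, Finset.mem_filter, Finset.mem_univ,
      true_and, and_true] at hf
    simp only [Function.update_idem, Function.update_self, Prod.mk.injEq, and_true]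
    conv_rhs => rw [← Function.update_eq_self b f]
    rw [hf.1]
  · intro f _
    simp
  · rintro ⟨f, a⟩ _
    exact (prod_update_eq M f b a).symm

/-- The point `b` lies on the only cycle of a map attracted to it. Cutting the arrow that enters `b`
along this cycle, from `a` say, leaves a tree rooted at `a`. Comparison with the cut of the arrow
leaving `b` gives the tree theorem. -/
lemma sum_attractedMaps_eq_sum (M : V → V → ℝ) (b : V) :
    ∑ f ∈ attractedMaps b, ∏ v, M v (f v) = ∑ a, treeWeight M a * M a b := by
  simp only [treeWeight, Finset.sum_mul]
  rw [← Finset.sum_sigma (Finset.univ : Finset V) (fun a => rootedMaps a)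
    (fun q : (_ : V) × (V → V) => (∏ v ∈ Finset.univ.erase q.1, M v (q.2 v)) * M q.1 b)]
  symm
  have hper : ∀ f ∈ attractedMaps b, b ∈ Function.periodicPts f := by
    intro f hf
    simp only [attractedMaps, Finset.mem_filter, Finset.mem_univ, true_and] at hf
    obtain ⟨k, hk⟩ := hf (f b)
    exact ⟨k + 1, k.succ_pos, hk⟩
  have hpred : ∀ f ∈ attractedMaps b, f (f^[Function.minimalPeriod f b - 1] b) = b := by
    intro f hf
    have h1 := Function.minimalPeriod_pos_of_mem_periodicPts (hper f hf)
    have h2 := Function.iterate_minimalPeriod (f := f) (x := b)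
    rw [← Function.iterate_succ_apply' f]
    rwa [Nat.succ_eq_add_one, Nat.sub_add_cancel h1]
  have hiter : ∀ f : V → V, b ∈ Function.periodicPts f → ∀ k, f^[k] b ∈ Function.periodicPts f := by
    intro f hb k
    induction k with
    | zero => exact hb
    | succ k ih =>
      rw [Function.iterate_succ_apply']
      exact (Function.bijOn_periodicPts f).mapsTo ih
  have hfwd : ∀ (a : V), ∀ f ∈ rootedMaps a, Function.update f a b ∈ attractedMaps b ∧
      ∃ k, (Function.update f a b)^[k] b = a := by
    intro a f hf
    simp only [rootedMaps, attractedMaps, Finset.mem_filter, Finset.mem_univ, true_and] at hf ⊢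
    have h := fun v => exists_iterate_eq_of_eq_off (g := Function.update f a b)
      (fun w hw => (Function.update_of_ne hw _ _).symm) v (hf.2 v)
    refine ⟨fun v => ?_, h b⟩
    obtain ⟨k, hk⟩ := h v
    exact ⟨k + 1, by rw [Function.iterate_succ_apply', hk, Function.update_self]⟩
  refine Finset.sum_nbij' (fun q : (_ : V) × (V → V) => Function.update q.2 q.1 b)
    -- The predecessor of `b` on the cycle is reached just before one full period has elapsed.
    (fun f => ⟨f^[Function.minimalPeriod f b - 1] b,
      Function.update f (f^[Function.minimalPeriod f b - 1] b)
        (f^[Function.minimalPeriod f b - 1] b)⟩) ?_ ?_ ?_ ?_ ?_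
  · rintro ⟨a, f⟩ hf
    exact (hfwd a f (Finset.mem_sigma.1 hf).2).1
  · intro f hf
    refine Finset.mem_sigma.2 ⟨Finset.mem_univ _, ?_⟩
    set a := f^[Function.minimalPeriod f b - 1] b with ha
    simp only [rootedMaps, attractedMaps, Finset.mem_filter, Finset.mem_univ,
      true_and, Function.update_self] at hf ⊢
    refine fun v => exists_iterate_eq_of_eq_off
      (fun w hw => (Function.update_of_ne hw _ _).symm) v ?_
    obtain ⟨k, hk⟩ := hf v
    exact ⟨Function.minimalPeriod f b - 1 + k, by rw [Function.iterate_add_apply, hk]⟩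
  · rintro ⟨a, f⟩ hf
    have hf' := (Finset.mem_sigma.1 hf).2
    obtain ⟨h1, k, hk⟩ := hfwd a f hf'
    have hfa : f a = a := by
      simp only [rootedMaps, Finset.mem_filter] at hf'
      exact hf'.2.1
    set g := Function.update f a b with hg
    have hp := hper g h1
    -- Both points are periodic and are mapped to `b`, and a map is injective on its periodic
    -- points.
    have key : g^[Function.minimalPeriod g b - 1] b = a := by
      refine (Function.bijOn_periodicPts g).injOn (hiter g hp _) (hk ▸ hiter g hp k) ?_
      rw [hpred g h1, hg, Function.update_self]
    rw [key]
    have : Function.update g a a = f := by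
      rw [hg, Function.update_idem]
      conv_rhs => rw [← Function.update_eq_self a f]
      rw [hfa]
    rw [this]
  · intro f hf
    simp only [Function.update_idem]
    conv_rhs => rw [← Function.update_eq_self (f^[Function.minimalPeriod f b - 1] b) f]
    rw [hpred f hf]
  · rintro ⟨a, f⟩ _
    exact (prod_update_eq M f a b).symm

/-- The Markov chain tree theorem: the tree weights are invariant. -/
lemma vecMul_treeWeight (M : Matrix V V ℝ) (hM : ∀ a, ∑ b, M a b = 1) :
    Matrix.vecMul (treeWeight M) M = treeWeight M := by
  funext b
  have h := (sum_attractedMaps_eq M b).symm.trans (sum_attractedMaps_eq_sum M b)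
  rw [hM, mul_one] at h
  simp only [Matrix.vecMul, dotProduct]
  exact h.symm

/-- If `v` reaches the root within `m` steps, then after `m * k` steps it is at the root, where it
stays, and also back at `v`. -/
lemma rootedMaps_fixed {s : V} {f : V → V} (hf : f ∈ rootedMaps s) {v : V} (k : ℕ) (hk : 0 < k)
    (h : f^[k] v = v) : v = s := by
  simp only [rootedMaps, Finset.mem_filter, Finset.mem_univ, true_and] at hf
  obtain ⟨m, hm⟩ := hf.2 v
  have h1 : f^[m * k] v = v := by
    rw [mul_comm, Function.iterate_mul]
    exact Function.iterate_fixed h m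
  have h2 : f^[m * k] v = s := by
    obtain ⟨d, hd⟩ := Nat.exists_eq_add_of_le (Nat.le_mul_of_pos_right m hk)
    rw [hd, add_comm, Function.iterate_add_apply, hm]
    exact Function.iterate_fixed hf.1 d
  exact h1.symm.trans h2

/-- The arrows of a map, those starting at `s` excepted. -/
def arrows (s : V) (f : V → V) : Finset (V × V) := (Finset.univ.erase s).image fun v => (v, f v)

lemma mem_arrows {s : V} {f : V → V} {a b : V} : (a, b) ∈ arrows s f ↔ a ≠ s ∧ f a = b := by
  simp only [arrows, Finset.mem_image, Finset.mem_erase, Finset.mem_univ, and_true, Prod.mk.injEq]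
  constructor
  · rintro ⟨v, hv, rfl, rfl⟩
    exact ⟨hv, rfl⟩
  · rintro ⟨h, rfl⟩
    exact ⟨a, h, rfl, rfl⟩

lemma isWGraph_arrows {s : V} {f : V → V} (hf : f ∈ rootedMaps s) : IsWGraph {s} (arrows s f) := by
  have hiter : ∀ a b, Relation.TransGen (fun b b' => (b, b') ∈ arrows s f) a b →
      a ≠ s ∧ ∃ k, 0 < k ∧ f^[k] a = b := by
    intro a b h
    induction h with
    | single h => exact ⟨(mem_arrows.1 h).1, 1, one_pos, (mem_arrows.1 h).2⟩
    | tail _ h ih =>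
      obtain ⟨h1, k, hk, hk'⟩ := ih
      exact ⟨h1, k + 1, k.succ_pos, by rw [Function.iterate_succ_apply', hk', (mem_arrows.1 h).2]⟩
  refine ⟨?_, ?_, ?_, ?_⟩
  · rintro ⟨a, b⟩ he
    exact (mem_arrows.1 he).1
  · rintro ⟨a, b⟩ he hab
    obtain ⟨h1, h2⟩ := mem_arrows.1 he
    exact h1 (rootedMaps_fixed hf 1 one_pos (h2.trans hab))
  · intro a ha
    exact ⟨f a, mem_arrows.2 ⟨ha, rfl⟩, fun b hb => (mem_arrows.1 hb).2.symm⟩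
  · intro a ha
    obtain ⟨h1, k, hk, hk'⟩ := hiter a a ha
    exact h1 (rootedMaps_fixed hf k hk hk')

lemma exists_rootedMap_of_isWGraph {s : V} {g : Finset (V × V)} (hg : IsWGraph {s} g) :
    ∃ f ∈ rootedMaps s, arrows s f = g := by
  choose! F hF hF' using hg.existsUnique
  have hFs : ∀ v, v ≠ s → Function.update F s s v = F v := fun v hv => Function.update_of_ne hv _ _
  have harr : arrows s (Function.update F s s) = g := by
    ext ⟨a, b⟩
    rw [mem_arrows]
    constructor
    · rintro ⟨h1, h2⟩
      rw [hFs a h1] at h2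
      exact h2 ▸ hF a h1
    · intro h
      have h1 : a ≠ s := hg.source_notMem _ h
      exact ⟨h1, by rw [hFs a h1]; exact (hF' a h1 b h).symm⟩
  refine ⟨Function.update F s s, ?_, harr⟩
  set f := Function.update F s s with hf
  simp only [rootedMaps, Finset.mem_filter, Finset.mem_univ, true_and]
  refine ⟨by rw [hf, Function.update_self], fun v => ?_⟩
  by_contra! hv
  -- An orbit that avoids the root must repeat a point, and the arrows between the two visits form a
  -- forbidden closed cycle.
  obtain ⟨m, k, hmk, he⟩ := Finite.exists_ne_map_eq_of_infinite fun k : ℕ => f^[k] v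
  wlog hlt : m < k generalizing m k
  · exact this k m hmk.symm he.symm (lt_of_le_of_ne (not_lt.1 hlt) hmk.symm)
  have htrans : ∀ d, Relation.TransGen (fun b b' => (b, b') ∈ g) (f^[m] v) (f^[m + d + 1] v) := by
    intro d
    have hstep : ∀ j, (f^[j] v, f^[j + 1] v) ∈ g := fun j => by
      rw [← harr, mem_arrows, Function.iterate_succ_apply']
      exact ⟨hv j, rfl⟩
    induction d with
    | zero => exact .single (hstep m)
    | succ d ih => exact ih.tail (hstep _)
  obtain ⟨d, rfl⟩ := Nat.exists_eq_add_of_lt hlt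
  have := htrans d
  rw [← he] at this
  exact hg.acyclic _ this

open Classical in
lemma sum_isWGraph_eq_treeWeight (M : V → V → ℝ) (s : V) :
    ∑ g ∈ Finset.univ.filter (fun g : Finset (V × V) => IsWGraph {s} g), ∏ e ∈ g, M e.1 e.2
      = treeWeight M s := by
  symm
  refine Finset.sum_bij (fun f _ => arrows s f) ?_ ?_ ?_ ?_
  · intro f hf
    simpa using isWGraph_arrows hf
  · intro f hf f' hf' h
    simp only [rootedMaps, Finset.mem_filter, Finset.mem_univ, true_and] at hf hf'
    funext v
    by_cases hv : v = s
    · rw [hv, hf.1, hf'.1]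
    · have : (v, f v) ∈ arrows s f := mem_arrows.2 ⟨hv, rfl⟩
      rw [h] at this
      exact (mem_arrows.1 this).2.symm
  · intro g hg
    obtain ⟨f, hf, h⟩ := exists_rootedMap_of_isWGraph (Finset.mem_filter.1 hg).2
    exact ⟨f, hf, h⟩
  · intro f _
    rw [arrows, Finset.prod_image]
    intro a _ b _ h
    exact (Prod.mk.inj h).1

/-- A stochastic matrix with positive entries along the arrows of a tree to every root has at most
one stationary distribution. -/
lemma IsStationary.unique {M : Matrix V V ℝ} (h0 : ∀ a b, 0 ≤ M a b) (h1 : ∀ a, ∑ b, M a b = 1)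
    (hirr : ∀ s, ∃ f ∈ rootedMaps s, ∀ v, v ≠ s → 0 < M v (f v)) {π π' : V → ℝ}
    (hπ : IsStationary M π) (hπ' : IsStationary M π') : π = π' := by
  set d : V → ℝ := fun v => π v - π' v with hd
  have hdM : ∀ b, ∑ a, d a * M a b = d b := by
    intro b
    have e1 := congrFun hπ.2 b
    have e2 := congrFun hπ'.2 b
    simp only [Matrix.vecMul, dotProduct] at e1 e2
    simp only [hd, sub_mul, Finset.sum_sub_distrib, e1, e2]
  have hsum : ∑ v, d v = 0 := by
    simp only [hd, Finset.sum_sub_distrib]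
    rw [hπ.1.2, hπ'.1.2, sub_self]
  -- The positive part of an invariant signed vector is subinvariant; as total mass is preserved, it
  -- is invariant. Its positivity then spreads along the trees to every point, contradicting that
  -- `d` sums to zero.
  set P : V → ℝ := fun v => max (d v) 0 with hP
  have hPle : ∀ b, P b ≤ ∑ a, P a * M a b := by
    intro b
    refine max_le ?_ (Finset.sum_nonneg fun a _ => mul_nonneg (le_max_right _ _) (h0 a b))
    rw [← hdM b]
    exact Finset.sum_le_sum fun a _ => mul_le_mul_of_nonneg_right (le_max_left _ _) (h0 a b)
  have htot : ∑ b, ∑ a, P a * M a b = ∑ b, P b := by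
    rw [Finset.sum_comm]
    exact Finset.sum_congr rfl fun a _ => by rw [← Finset.mul_sum, h1, mul_one]
  have hPM : ∀ b, P b = ∑ a, P a * M a b := by
    intro b
    exact (Finset.sum_eq_sum_iff_of_le fun b _ => hPle b).1 htot.symm b (Finset.mem_univ b)
  have hP0 : ∀ v, d v ≤ 0 := by
    by_contra! hv
    obtain ⟨v, hv⟩ := hv
    have hPv : 0 < P v := lt_max_of_lt_left hv
    have hall : ∀ s, 0 < P s := by
      intro s
      obtain ⟨f, hf, hfM⟩ := hirr s
      have hf' := hf
      simp only [rootedMaps, Finset.mem_filter, Finset.mem_univ, true_and] at hf'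
      have hstep : ∀ w, 0 < P w → 0 < P (f w) := by
        intro w hw
        by_cases hws : w = s
        · rw [hws, hf'.1, ← hws]; exact hw
        · rw [hPM (f w)]
          refine lt_of_lt_of_le (mul_pos hw (hfM w hws))
            (Finset.single_le_sum (f := fun a => P a * M a (f w))
              (fun a _ => mul_nonneg (le_max_right _ _) (h0 _ _)) (Finset.mem_univ w))
      obtain ⟨k, hk⟩ := hf'.2 v
      rw [← hk]
      clear hk
      induction k with
      | zero => exact hPv
      | succ k ih => rw [Function.iterate_succ_apply']; exact hstep _ ih
    have hpos : 0 < ∑ s, d s := Finset.sum_pos (fun s _ => by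
      by_contra! h
      have := hall s
      rw [hP] at this
      simp only [max_eq_right h, lt_irrefl] at this) ⟨v, Finset.mem_univ v⟩
    exact hpos.ne' hsum
  have := (Finset.sum_eq_zero_iff_of_nonpos fun v _ => hP0 v).1 hsum
  funext v
  exact sub_eq_zero.1 (this v (Finset.mem_univ v))

end Trees

/-! ### Hitting probabilities, expectations and submartingales for a general Markov kernel. -/

section Kernels

variable {α : Type*} [MeasurableSpace α]

/-- The law of the path of the homogeneous Markov chain with transition kernel `κ`, started
at `z`. -/
def chainLaw (κ : Kernel α α) [IsMarkovKernel κ] (z : α) : Measure (ℕ → α) :=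
  Kernel.traj (X := fun _ => α)
    (fun t => κ.comap (fun ω : (i : Finset.Iic t) → α => ω ⟨t, Finset.mem_Iic.2 le_rfl⟩)
      (measurable_pi_apply _)) 0 (fun _ => z)

instance (κ : Kernel α α) [IsMarkovKernel κ] (z : α) : IsProbabilityMeasure (chainLaw κ z) := by
  unfold chainLaw; infer_instance

/-- The Markov property with the whole past retained, as the event of an earlier visit depends on
all previous positions. -/
lemma lintegral_chainLaw_succ (κ : Kernel α α) [IsMarkovKernel κ] (z : α) (t : ℕ)
    {F : ((i : Finset.Iic t) → α) × α → ℝ≥0∞} (hF : Measurable F) :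
    ∫⁻ ω, F (Preorder.frestrictLe t ω, ω (t + 1)) ∂chainLaw κ z
      = ∫⁻ ω, ∫⁻ y, F (Preorder.frestrictLe t ω, y) ∂κ (ω t) ∂chainLaw κ z := by
  have h := Kernel.partialTraj_compProd_eq_map_traj (X := fun _ => α)
    (κ := fun t => κ.comap (fun ω : (i : Finset.Iic t) → α => ω ⟨t, Finset.mem_Iic.2 le_rfl⟩)
      (measurable_pi_apply _)) (Nat.zero_le t) (x₀ := fun _ => z)
  have h1 := lintegral_map (μ := chainLaw κ z) hF
    (g := fun ω : ℕ → α => (Preorder.frestrictLe (π := fun _ => α) t ω, ω (t + 1)))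
    (by fun_prop)
  rw [← h1, chainLaw, ← h, Measure.lintegral_compProd hF, ← Kernel.traj_map_frestrictLe,
    Kernel.map_apply _ (by fun_prop), lintegral_map _ (by fun_prop)]
  · rfl
  · exact Measurable.lintegral_kernel_prod_right' hF

lemma lintegral_chainLaw_zero (κ : Kernel α α) [IsMarkovKernel κ] (z : α)
    {f : α → ℝ≥0∞} (hf : Measurable f) : ∫⁻ ω, f (ω 0) ∂chainLaw κ z = f z := by
  have hm : Measurable fun ω : ℕ → α => f (ω 0) := hf.comp (measurable_pi_apply 0)
  rw [chainLaw, Kernel.lintegral_traj _ hm]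
  simp [Function.updateFinset]

/-- The probability of a visit to `B` within `t` steps. -/
def hitWithin (κ : Kernel α α) (B : Set α) : ℕ → α → ℝ≥0∞
  | 0 => B.indicator 1
  | t + 1 => fun z => max (B.indicator 1 z) (∫⁻ y, hitWithin κ B t y ∂κ z)

lemma measurable_hitWithin (κ : Kernel α α) {B : Set α} (hB : MeasurableSet B) (t : ℕ) :
    Measurable (hitWithin κ B t) := by
  induction t with
  | zero => exact measurable_one.indicator hB
  | succ t ih => exact (measurable_one.indicator hB).max ih.lintegral_kernel

lemma hitWithin_le_one (κ : Kernel α α) [IsMarkovKernel κ] (B : Set α) (t : ℕ) (z : α) :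
    hitWithin κ B t z ≤ 1 := by
  have h0 : B.indicator (1 : α → ℝ≥0∞) z ≤ 1 := Set.indicator_le_self' (by simp) z
  induction t generalizing z with
  | zero => exact h0
  | succ t ih =>
    refine max_le h0 ?_
    calc _ ≤ ∫⁻ y, 1 ∂κ z := lintegral_mono fun y => ih y (Set.indicator_le_self' (by simp) y)
      _ = 1 := by simp

lemma hitWithin_of_mem (κ : Kernel α α) [IsMarkovKernel κ] {B : Set α} (t : ℕ) {z : α}
    (hz : z ∈ B) : hitWithin κ B t z = 1 := by
  refine le_antisymm (hitWithin_le_one κ B t z) ?_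
  cases t with
  | zero => simp [hitWithin, hz]
  | succ t => exact le_max_of_le_left (by simp [hz])

lemma hitWithin_succ_of_notMem (κ : Kernel α α) {B : Set α} (t : ℕ) {z : α}
    (hz : z ∉ B) : hitWithin κ B (t + 1) z = ∫⁻ y, hitWithin κ B t y ∂κ z := by
  simp [hitWithin, hz]

lemma hitWithin_mono (κ : Kernel α α) [IsMarkovKernel κ] (B : Set α) :
    Monotone (hitWithin κ B) := by
  refine monotone_nat_of_le_succ fun t => ?_
  induction t with
  | zero => exact fun z => le_max_left _ _
  | succ t ih =>
    intro z
    by_cases hz : z ∈ B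
    · rw [hitWithin_of_mem κ _ hz, hitWithin_of_mem κ _ hz]
    · rw [hitWithin_succ_of_notMem κ _ hz, hitWithin_succ_of_notMem κ _ hz]
      exact lintegral_mono ih

lemma chainLaw_hit_within (κ : Kernel α α) [IsMarkovKernel κ] {B : Set α} (hB : MeasurableSet B)
    (z : α) (T : ℕ) : chainLaw κ z {ω | ∃ t ≤ T, ω t ∈ B} = hitWithin κ B T z := by
  classical
  -- The conditional probability of a visit by time `T`, given the path up to time `s`, is a
  -- martingale in `s`. At `s = 0` its mean is the recursive value, at `s = T` it is the probability
  -- on path space.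
  have key : ∀ s, s ≤ T → ∫⁻ ω, (if ∃ t ≤ s, ω t ∈ B then 1 else hitWithin κ B (T - s) (ω s))
      ∂chainLaw κ z = hitWithin κ B T z := by
    intro s hs
    induction s with
    | zero =>
      rw [← lintegral_chainLaw_zero κ z (measurable_hitWithin κ hB T)]
      refine lintegral_congr fun ω => ?_
      simp only [Nat.le_zero, exists_eq_left, Nat.sub_zero]
      split_ifs with h
      · exact (hitWithin_of_mem κ T h).symm
      · rfl
    | succ s ih =>
      rw [← ih (by omega)]
      set E : Set ((i : Finset.Iic s) → α) := {x | ∃ i, x i ∈ B} with hE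
      have hEm : MeasurableSet E := by
        rw [hE, Set.ofPred_exists]
        exact MeasurableSet.iUnion fun i => measurable_pi_apply i hB
      have hmem : ∀ ω : ℕ → α, Preorder.frestrictLe (π := fun _ => α) s ω ∈ E ↔ ∃ t ≤ s, ω t ∈ B := by
        intro ω
        simp only [hE, Set.mem_ofPred_eq, Subtype.exists, Finset.mem_Iic]
        exact ⟨fun ⟨t, ht, h⟩ => ⟨t, ht, h⟩, fun ⟨t, ht, h⟩ => ⟨t, ht, h⟩⟩
      set F : ((i : Finset.Iic s) → α) × α → ℝ≥0∞ :=
        fun q => if q.1 ∈ E then 1 else hitWithin κ B (T - (s + 1)) q.2 with hF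
      have hFm : Measurable F := Measurable.ite (measurable_fst hEm) measurable_const
        ((measurable_hitWithin κ hB _).comp measurable_snd)
      have h1 := lintegral_chainLaw_succ κ z s hFm
      calc _ = ∫⁻ ω, F (Preorder.frestrictLe s ω, ω (s + 1)) ∂chainLaw κ z := by
            refine lintegral_congr fun ω => ?_
            simp only [hF, hmem]
            by_cases h : ∃ t ≤ s, ω t ∈ B
            · have : ∃ t ≤ s + 1, ω t ∈ B := by
                obtain ⟨t, ht, h⟩ := h
                exact ⟨t, by omega, h⟩
              rw [if_pos h, if_pos this]
            · rw [if_neg h]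
              split_ifs with h'
              · obtain ⟨t, ht, h'⟩ := h'
                rcases Nat.le_succ_iff.1 ht with ht | rfl
                · exact absurd ⟨t, ht, h'⟩ h
                · exact (hitWithin_of_mem κ _ h').symm
              · rfl
        _ = _ := h1
        _ = _ := by
            refine lintegral_congr fun ω => ?_
            simp only [hF, hmem]
            split_ifs with h
            · simp
            · have hn : ω s ∉ B := fun h' => h ⟨s, le_rfl, h'⟩
              rw [show T - s = T - (s + 1) + 1 by omega, hitWithin_succ_of_notMem κ _ hn]
  rw [← key T le_rfl, ← lintegral_indicator_one]
  · refine lintegral_congr fun ω => ?_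
    simp only [Set.indicator_apply, Set.mem_ofPred_eq, Pi.one_apply, Nat.sub_self]
    split_ifs with h
    · rfl
    · have : ω T ∉ B := fun h' => h ⟨T, le_rfl, h'⟩
      simp [hitWithin, this]
  · simp only [Set.ofPred_exists]
    refine MeasurableSet.iUnion fun t => ?_
    by_cases h : t ≤ T
    · have hm : Measurable fun ω : ℕ → α => ω t := measurable_pi_apply t
      simp only [h, true_and]
      exact hm hB
    · simp [h]

lemma chainLaw_hit (κ : Kernel α α) [IsMarkovKernel κ] {B : Set α} (hB : MeasurableSet B)
    (z : α) : chainLaw κ z {ω | ∃ t, ω t ∈ B} = ⨆ T, hitWithin κ B T z := by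
  have : {ω : ℕ → α | ∃ t, ω t ∈ B} = ⋃ T, {ω | ∃ t ≤ T, ω t ∈ B} := by
    ext ω
    simp only [Set.mem_ofPred_eq, Set.mem_iUnion]
    exact ⟨fun ⟨t, h⟩ => ⟨t, t, le_rfl, h⟩, fun ⟨_, t, _, h⟩ => ⟨t, h⟩⟩
  rw [this, Monotone.measure_iUnion]
  · simp only [chainLaw_hit_within κ hB]
  · intro T T' hT ω
    simp only [Set.mem_ofPred_eq]
    exact fun ⟨t, h, h'⟩ => ⟨t, h.trans hT, h'⟩

lemma pow_succ_apply' (κ : Kernel α α) (t : ℕ) (z : α) {s : Set α} (hs : MeasurableSet s) :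
    (κ ^ (t + 1)) z s = ∫⁻ y, (κ ^ t) y s ∂κ z := by
  rw [add_comm]
  simpa using Kernel.pow_add_apply_eq_lintegral κ 1 t z hs

instance (κ : Kernel α α) [IsMarkovKernel κ] (t : ℕ) : IsMarkovKernel (κ ^ t) := by
  induction t with
  | zero => rw [pow_zero]; exact inferInstanceAs (IsMarkovKernel Kernel.id)
  | succ t ih => rw [pow_succ]; exact inferInstanceAs (IsMarkovKernel ((κ ^ t) ∘ₖ κ))

lemma pow_le_hitWithin (κ : Kernel α α) [IsMarkovKernel κ] {B : Set α} (hB : MeasurableSet B)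
    (t : ℕ) (z : α) : (κ ^ t) z B ≤ hitWithin κ B t z := by
  induction t generalizing z with
  | zero =>
    rw [pow_zero]
    change Kernel.id z B ≤ _
    rw [Kernel.id_apply, Measure.dirac_apply' _ hB]
    exact le_rfl
  | succ t ih =>
    rw [pow_succ_apply' κ t z hB]
    exact le_max_of_le_right (lintegral_mono ih)

/-- The expectation of `f` after `t` steps of the chain started at `z`. -/
def expect (κ : Kernel α α) (f : α → ℝ) : ℕ → α → ℝ
  | 0 => f
  | t + 1 => fun z => ∫ y, expect κ f t y ∂κ z

/-- Measurable functions with values in `[0, 1]`. -/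
structure IsUnitFun (f : α → ℝ) : Prop where
  measurable : Measurable f
  nonneg : ∀ z, 0 ≤ f z
  le_one : ∀ z, f z ≤ 1

lemma IsUnitFun.integrable {f : α → ℝ} (hf : IsUnitFun f) (μ : Measure α) [IsFiniteMeasure μ] :
    Integrable f μ :=
  Integrable.of_bound hf.measurable.aestronglyMeasurable 1
    (ae_of_all _ fun z => by rw [Real.norm_of_nonneg (hf.nonneg z)]; exact hf.le_one z)

lemma IsUnitFun.expect {κ : Kernel α α} [IsMarkovKernel κ] {f : α → ℝ} (hf : IsUnitFun f) (t : ℕ) :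
    IsUnitFun (expect κ f t) := by
  induction t with
  | zero => exact hf
  | succ t ih =>
    refine ⟨?_, fun z => integral_nonneg ih.nonneg, fun z => ?_⟩
    · exact (ih.measurable.stronglyMeasurable.integral_kernel).measurable
    · calc _ ≤ ∫ _, (1 : ℝ) ∂κ z := integral_mono (ih.integrable _) (integrable_const _) ih.le_one
        _ = 1 := by simp

lemma ofReal_expect_indicator (κ : Kernel α α) [IsMarkovKernel κ] {B : Set α}
    (hB : MeasurableSet B) (t : ℕ) (z : α) :
    ENNReal.ofReal (expect κ (B.indicator 1) t z) = (κ ^ t) z B := by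
  have hu : IsUnitFun (B.indicator (1 : α → ℝ)) :=
    ⟨measurable_one.indicator hB, fun z => Set.indicator_nonneg (by simp) z,
      fun z => Set.indicator_le_self' (by simp) z⟩
  induction t generalizing z with
  | zero =>
    rw [pow_zero]
    change _ = Kernel.id z B
    rw [Kernel.id_apply, Measure.dirac_apply' _ hB]
    by_cases h : z ∈ B <;> simp [expect, h]
  | succ t ih =>
    rw [pow_succ_apply' κ t z hB, expect,
      ofReal_integral_eq_lintegral_ofReal ((hu.expect t).integrable _)
        (ae_of_all _ (hu.expect t).nonneg)]
    exact lintegral_congr ih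

lemma expect_add {f g : α → ℝ} (κ : Kernel α α) [IsMarkovKernel κ] (hf : IsUnitFun f)
    (hg : IsUnitFun g) (t : ℕ) (z : α) :
    expect κ (fun z => f z + g z) t z = expect κ f t z + expect κ g t z := by
  induction t generalizing z with
  | zero => rfl
  | succ t ih =>
    simp only [expect, ih]
    exact integral_add ((hf.expect t).integrable _) ((hg.expect t).integrable _)

lemma expect_const (κ : Kernel α α) [IsMarkovKernel κ] (c : ℝ) (t : ℕ) (z : α) :
    expect κ (fun _ => c) t z = c := by
  induction t generalizing z with
  | zero => rfl
  | succ t ih => simp [expect, ih]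

/-- `S` is absorbing: the chain started in `S` almost surely stays there. -/
def IsAbsorbing (κ : Kernel α α) (S : Set α) : Prop := ∀ z ∈ S, ∀ᵐ y ∂κ z, y ∈ S

variable {κ : Kernel α α} [IsMarkovKernel κ] {S : Set α}

/-- A one-step drift inequality on an absorbing set propagates in time by monotonicity of the
integral. The case `c = 0` is the submartingale property. -/
lemma expect_add_le {f g : α → ℝ} (hf : IsUnitFun f) (hg : IsUnitFun g) {c : ℝ}
    (hS : IsAbsorbing κ S) (h : ∀ z ∈ S, f z + c * g z ≤ expect κ f 1 z) (t : ℕ) :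
    ∀ z ∈ S, expect κ f t z + c * expect κ g t z ≤ expect κ f (t + 1) z := by
  induction t with
  | zero => exact h
  | succ t ih =>
    intro z hz
    rw [expect, expect, ← integral_const_mul,
      ← integral_add ((hf.expect t).integrable _) (((hg.expect t).integrable _).const_mul c)]
    refine integral_mono_ae (((hf.expect t).integrable _).add
      (((hg.expect t).integrable _).const_mul c)) ((hf.expect (t + 1)).integrable _) ?_
    filter_upwards [hS z hz] with y hy using ih y hy

lemma expect_mono {f g : α → ℝ} (hf : IsUnitFun f) (hg : IsUnitFun g)
    (hS : IsAbsorbing κ S) (h : ∀ z ∈ S, f z ≤ g z) (t : ℕ) :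
    ∀ z ∈ S, expect κ f t z ≤ expect κ g t z := by
  induction t with
  | zero => exact h
  | succ t ih =>
    intro z hz
    refine integral_mono_ae ((hf.expect t).integrable _) ((hg.expect t).integrable _) ?_
    filter_upwards [hS z hz] with y hy using ih y hy

lemma expect_le_succ {f : α → ℝ} (hf : IsUnitFun f) (hS : IsAbsorbing κ S)
    (h : ∀ z ∈ S, f z ≤ expect κ f 1 z) (t : ℕ) {z : α} (hz : z ∈ S) :
    expect κ f t z ≤ expect κ f (t + 1) z := by
  have := expect_add_le hf hf (c := 0) hS (by simpa using h) t z hz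
  simpa using this

omit [IsMarkovKernel κ] in
lemma expect_add_time (f : α → ℝ) (s t : ℕ) :
    expect κ f (t + s) = expect κ (expect κ f s) t := by
  induction t with
  | zero => simp [expect]
  | succ t ih =>
    rw [Nat.add_right_comm]
    funext z
    rw [expect, expect, ih]

/-- A maximal inequality: `f` is at least `c` on `B`, so a visit to `B` has probability at most
the expectation of `f / c`. -/
lemma mul_hitWithin_le {f : α → ℝ} (hf : IsUnitFun f) (hS : IsAbsorbing κ S)
    (h : ∀ z ∈ S, f z ≤ expect κ f 1 z) {B : Set α} {c : ℝ}
    (hc : ∀ z ∈ S, z ∈ B → c ≤ f z) (t : ℕ) :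
    ∀ z ∈ S, ENNReal.ofReal c * hitWithin κ B t z ≤ ENNReal.ofReal (expect κ f t z) := by
  -- Once the chain is in `B`, the submartingale keeps the expectation at least `c` for any
  -- remaining horizon.
  have hB : ∀ t, ∀ z ∈ S, z ∈ B → c ≤ expect κ f t z := by
    intro t z hz hzB
    induction t with
    | zero => exact hc z hz hzB
    | succ t ih => exact ih.trans (expect_le_succ hf hS h t hz)
  have hin : ∀ t, ∀ z ∈ S, z ∈ B →
      ENNReal.ofReal c * hitWithin κ B t z ≤ ENNReal.ofReal (expect κ f t z) := by
    intro t z hz hzB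
    rw [hitWithin_of_mem κ t hzB, mul_one]
    exact ENNReal.ofReal_le_ofReal (hB t z hz hzB)
  induction t with
  | zero =>
    intro z hz
    by_cases hzB : z ∈ B
    · exact hin 0 z hz hzB
    · simp [hitWithin, hzB]
  | succ t ih =>
    intro z hz
    by_cases hzB : z ∈ B
    · exact hin _ z hz hzB
    · rw [hitWithin_succ_of_notMem κ t hzB, expect,
        ofReal_integral_eq_lintegral_ofReal ((hf.expect t).integrable _)
          (ae_of_all _ (hf.expect t).nonneg), ← lintegral_const_mul' _ _ ENNReal.ofReal_ne_top]
      refine lintegral_mono_ae ?_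
      filter_upwards [hS z hz] with y hy using ih y hy

end Kernels

/-! ### Real inequalities behind the submartingale and its geometric rate. -/

section Inequalities

/-- Bernoulli's inequality for `1 + θ (1 - x) / x`: since `(k + 1) θ ≥ 1`, its power `k + 1` is at
least `1 / x`, so the reinforcement gains a factor that pays for the probability of playing the
action. -/
lemma pow_le_add_mul_pow {x θ η : ℝ} {k : ℕ} (hx0 : 0 ≤ x) (hx1 : x ≤ 1) (hη : 1 ≤ (k + 1) * η)
    (hθ : η ≤ θ) : x ^ k ≤ (x + θ * (1 - x)) ^ (k + 1) := by
  have hk : (0 : ℝ) < k + 1 := by positivity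
  have hkθ : 1 ≤ (k + 1) * θ := hη.trans (mul_le_mul_of_nonneg_left hθ hk.le)
  have hθ0 : 0 < θ := by
    by_contra! h
    nlinarith
  rcases hx0.eq_or_lt with rfl | hx
  · rcases Nat.eq_zero_or_pos k with rfl | hk
    · simp at hkθ ⊢
      exact hkθ
    · rw [zero_pow hk.ne']
      simp only [sub_zero, mul_one, zero_add]
      positivity
  · have hd : 0 ≤ θ * (1 - x) / x := by
      have := sub_nonneg.2 hx1
      positivity
    have h := one_add_mul_le_pow (show -2 ≤ θ * (1 - x) / x by linarith) (k + 1)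
    have h1 : 1 / x ≤ 1 + ((k + 1 : ℕ) : ℝ) * (θ * (1 - x) / x) := by
      have : 1 / x = 1 + 1 * (1 - x) / x := by field_simp; ring
      rw [this, ← mul_div_assoc, ← mul_assoc]
      push_cast
      gcongr
    have h2 : x + θ * (1 - x) = x * (1 + θ * (1 - x) / x) := by field_simp
    rw [h2, mul_pow]
    calc x ^ k = x ^ (k + 1) * (1 / x) := by
          rw [mul_one_div, eq_div_iff hx.ne']
          ring
      _ ≤ _ := by gcongr; exact h1.trans h

/-- The exponent exceeds that of the previous inequality by one: the spare factor `x + θ (1 - x)`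
produces the strict drift. The right side counts only the event that the action is played again. -/
lemma pow_add_le_mul_pow {x θ η : ℝ} {k : ℕ} (hx0 : 0 ≤ x) (hx1 : x ≤ 1) (hη : 1 ≤ (k + 1) * η)
    (hθ : η ≤ θ) :
    x ^ (k + 2) + η * (x ^ (k + 1) * (1 - x)) ≤ x * (x + θ * (1 - x)) ^ (k + 2) := by
  have h1 := sub_nonneg.2 hx1
  have hη0 : 0 < η := by
    by_contra! h
    have hk : (0 : ℝ) < k + 1 := by positivity
    nlinarith
  have ha : 0 ≤ x + θ * (1 - x) := by nlinarith
  have h := pow_le_add_mul_pow hx0 hx1 hη hθ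
  calc _ ≤ x ^ (k + 2) + θ * (x ^ (k + 1) * (1 - x)) := by gcongr
    _ = x * (x + θ * (1 - x)) * x ^ k := by ring
    _ ≤ x * (x + θ * (1 - x)) * (x + θ * (1 - x)) ^ (k + 1) := by gcongr
    _ = _ := by ring

/-- The constant in the Lyapunov inequality. -/
def lyapunovRate (η : ℝ) (k : ℕ) : ℝ := η * (1 / 2) ^ k / (2 * (k + 1))

lemma lyapunovRate_pos {η : ℝ} (hη : 0 < η) (k : ℕ) : 0 < lyapunovRate η k := by
  unfold lyapunovRate; positivity

lemma lyapunovRate_le_one {η : ℝ} (hη : 0 ≤ η) (hη1 : η ≤ 1) (k : ℕ) : lyapunovRate η k ≤ 1 := by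
  unfold lyapunovRate
  rw [div_le_one (by positivity)]
  have h1 : ((1 : ℝ) / 2) ^ k ≤ 1 := pow_le_one₀ (by norm_num) (by norm_num)
  have h2 : (0 : ℝ) ≤ (1 / 2) ^ k := by positivity
  have h3 : (0 : ℝ) ≤ k := by positivity
  nlinarith

/-- The two drifts add up to `η x (1 - x) (x ^ k + (1 - x) ^ k)`, where the last factor is at least
`(1 / 2) ^ k` because one of `x`, `1 - x` is at least a half. The defect on the left is at most `2
(k + 1) x (1 - x)` by Bernoulli; the rate is the quotient of the two constants. -/
lemma lyapunovRate_mul_le {x η : ℝ} (k : ℕ) (hx0 : 0 ≤ x) (hx1 : x ≤ 1) (hη : 0 ≤ η) :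
    lyapunovRate η k * (1 - (x ^ (k + 2) + (1 - x) ^ (k + 2)))
      ≤ η * (x ^ (k + 1) * (1 - x)) + η * ((1 - x) ^ (k + 1) * x) := by
  have hb : ∀ w : ℝ, 0 ≤ w → w ≤ 1 → 1 - w ^ (k + 1) ≤ (k + 1) * (1 - w) := by
    intro w hw0 hw1
    have := one_add_mul_le_pow (show -2 ≤ w - 1 by linarith) (k + 1)
    rw [add_sub_cancel] at this
    push_cast at this
    linarith
  have h1 := sub_nonneg.2 hx1
  have hhalf : (1 / 2 : ℝ) ^ k ≤ x ^ k + (1 - x) ^ k := by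
    rcases le_total (1 / 2) x with h | h
    · exact (pow_le_pow_left₀ (by norm_num) h k).trans (le_add_of_nonneg_right (by positivity))
    · exact (pow_le_pow_left₀ (by norm_num) (by linarith) k).trans
        (le_add_of_nonneg_left (by positivity))
  have hΦ : 1 - (x ^ (k + 2) + (1 - x) ^ (k + 2)) ≤ 2 * (k + 1) * (x * (1 - x)) := by
    have e1 := mul_le_mul_of_nonneg_left (hb x hx0 hx1) hx0
    have e2 := mul_le_mul_of_nonneg_left (hb (1 - x) h1 (by linarith)) h1
    have e3 : x * (1 - x ^ (k + 1)) + (1 - x) * (1 - (1 - x) ^ (k + 1))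
        = 1 - (x ^ (k + 2) + (1 - x) ^ (k + 2)) := by ring
    rw [← e3]
    calc _ ≤ _ := add_le_add e1 e2
      _ = _ := by ring
  calc _ ≤ lyapunovRate η k * (2 * (k + 1) * (x * (1 - x))) := by
        refine mul_le_mul_of_nonneg_left hΦ ?_
        unfold lyapunovRate; positivity
    _ = η * (1 / 2) ^ k * (x * (1 - x)) := by unfold lyapunovRate; field_simp
    _ ≤ η * (x ^ k + (1 - x) ^ k) * (x * (1 - x)) := by
        have : 0 ≤ x * (1 - x) := mul_nonneg hx0 h1
        gcongr
    _ = _ := by ring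

lemma le_aspirationFactor {h c x y : ℝ} (hx : h ≤ x) : h ≤ aspirationFactor h c x y := by
  unfold aspirationFactor
  split_ifs
  · exact hx
  · exact le_max_left _ _

lemma aspirationFactor_le {h c x y : ℝ} (hc : 0 ≤ c) (hx : h ≤ x) :
    aspirationFactor h c x y ≤ x := by
  unfold aspirationFactor
  split_ifs with hy
  · exact le_rfl
  · exact max_le hx (by nlinarith)

end Inequalities

/-! ### One update of the state on an edge. -/

section Dynamics

variable {n : ℕ} {A : Fin n → Type*} [∀ i, Fintype (A i)] [∀ i, DecidableEq (A i)]

/-- The constraints on the design parameters. -/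
structure Admissible (G : Params A) : Prop where
  ε_pos : 0 < G.ε
  h_pos : 0 < G.h
  c_pos : 0 < G.c
  ν_pos : 0 < G.ν
  step_lt_one : G.ε * G.ν < 1

/-- The noise values for which the reinforcement steps are in `[ε h, 1]`. -/
def TameAt (G : Params A) (υ : Fin n → ℝ) : Prop :=
  ∀ i α, G.h ≤ measuredUtility G α υ i ∧ G.ε * measuredUtility G α υ i ≤ 1

/-- The `ℓ^p` distance between the aspiration levels of `z` and the utilities of `α`. -/
def aspDist (p : ℝ≥0∞) [Fact (1 ≤ p)] (G : Params A) (α : Profile A) (z : State A) : ℝ :=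
  ‖(WithLp.toLp p (fun i => z.2.2.1 i - G.u i α) : PiLp p fun _ : Fin n => ℝ)‖

/-- The `ℓ^p` distance between the utilities of two profiles. -/
def utilDist (p : ℝ≥0∞) [Fact (1 ≤ p)] (G : Params A) (α β : Profile A) : ℝ :=
  ‖(WithLp.toLp p (fun i => G.u i α - G.u i β) : PiLp p fun _ : Fin n => ℝ)‖

lemma utilDist_comm (p : ℝ≥0∞) [Fact (1 ≤ p)] (G : Params A) (α β : Profile A) :
    utilDist p G α β = utilDist p G β α := by
  unfold utilDist
  rw [← norm_neg, ← WithLp.toLp_neg]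
  congr 2
  funext i
  simp

/-- In `z` the strategy of every player `i` is the mixture of `β i` and `α i` with weights `1 - y`
and `y`. -/
def OnEdge (α β : Profile A) (y : ℝ) (z : State A) : Prop :=
  ∀ i b, (z.2.1 i).1 b = (Pi.single (β i) 1 : A i → ℝ) b
    + y * ((Pi.single (α i) 1 : A i → ℝ) b - (Pi.single (β i) 1 : A i → ℝ) b)

variable {α β : Profile A} {j : Fin n} {G : Params A} {z : State A} {y : ℝ}

lemma OnEdge.symm (h : OnEdge α β y z) : OnEdge β α (1 - y) z := by
  intro i b
  rw [h i b]
  ring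

lemma OnEdge.eq_apply (h : OnEdge α β y z) (hj : α j ≠ β j) : (z.2.1 j).1 (α j) = y := by
  rw [h j (α j)]
  simp [hj]

lemma OnEdge.eq_apply' (h : OnEdge α β y z) (hj : α j ≠ β j) : (z.2.1 j).1 (β j) = 1 - y :=
  h.symm.eq_apply hj.symm

lemma OnEdge.mem_Icc (h : OnEdge α β y z) (hj : α j ≠ β j) : 0 ≤ y ∧ y ≤ 1 := by
  have h1 := (z.2.1 j).2.1 (α j)
  have h2 := (z.2.1 j).2.1 (β j)
  rw [h.eq_apply hj] at h1
  rw [h.eq_apply' hj] at h2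
  exact ⟨h1, by linarith⟩

/-- The aspiration factor lies between `h` and the measured utility. In particular the truncation in
`reinforce` is inactive. -/
lemma step_bounds (hG : Admissible G) {υ : Fin n → ℝ} (hυ : TameAt G υ) (γ : Profile A) (i : Fin n)
    (w : ℝ) : G.ε * G.h ≤ G.ε * aspirationFactor G.h G.c (measuredUtility G γ υ i) w ∧
      0 ≤ G.ε * aspirationFactor G.h G.c (measuredUtility G γ υ i) w ∧
      G.ε * aspirationFactor G.h G.c (measuredUtility G γ υ i) w ≤ 1 := by
  have h1 := mul_le_mul_of_nonneg_left
    (le_aspirationFactor (c := G.c) (y := w) (hυ i γ).1) hG.ε_pos.le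
  refine ⟨h1, (mul_pos hG.ε_pos hG.h_pos).le.trans h1, le_trans ?_ (hυ i γ).2⟩
  exact mul_le_mul_of_nonneg_left (aspirationFactor_le hG.c_pos.le (hυ i γ).1) hG.ε_pos.le

/-- Players other than `j` sit at the vertex they reinforce, so their steps have no effect and `θ`
is the step of player `j`. The case `α j = β j` is allowed. -/
lemma OnEdge.next (hG : Admissible G) {υ : Fin n → ℝ} (hυ : TameAt G υ)
    (hij : ∀ i, i ≠ j → α i = β i) (h : OnEdge α β y z) :
    ∃ θ, G.ε * G.h ≤ θ ∧ θ ≤ 1 ∧ OnEdge α β ((1 - θ) * y) (next G z β υ) := by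
  obtain ⟨h1, -, h2⟩ := step_bounds hG hυ β j (measuredUtility G β υ j - z.2.2.1 j)
  refine ⟨_, h1, h2, fun i b => ?_⟩
  obtain ⟨-, h3, h4⟩ := step_bounds hG hυ β i (measuredUtility G β υ i - z.2.2.1 i)
  have e := congrFun (coe_reinforce (z.2.1 i) (β i) h3 h4) b
  have e' : ((APLA.next G z β υ).2.1 i).1 b = (z.2.1 i).1 b +
    (G.ε * aspirationFactor G.h G.c (measuredUtility G β υ i)
      (measuredUtility G β υ i - z.2.2.1 i)) * ((Pi.single (β i) 1 : A i → ℝ) b - (z.2.1 i).1 b) := e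
  rw [e', h i b]
  by_cases hi : i = j
  · subst hi
    ring
  · rw [hij i hi]
    ring

lemma OnEdge.playProb_left (h : OnEdge α β y z) (hij : ∀ i, i ≠ j → α i = β i)
    (hj : α j ≠ β j) : playProb z α = y := by
  unfold playProb
  rw [Finset.prod_eq_single j]
  · exact h.eq_apply hj
  · intro i _ hi
    rw [h i, hij i hi]
    simp
  · simp

lemma OnEdge.playProb_right (h : OnEdge α β y z) (hij : ∀ i, i ≠ j → α i = β i)
    (hj : α j ≠ β j) : playProb z β = 1 - y :=
  h.symm.playProb_left (fun i hi => (hij i hi).symm) hj.symm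

lemma OnEdge.playProb_other (h : OnEdge α β y z) (hij : ∀ i, i ≠ j → α i = β i)
    {γ : Profile A} (h1 : γ ≠ α) (h2 : γ ≠ β) : playProb z γ = 0 := by
  unfold playProb
  by_cases hγ : ∀ i, i ≠ j → γ i = β i
  · refine Finset.prod_eq_zero (Finset.mem_univ j) ?_
    have h1' : γ j ≠ α j := by
      intro e
      refine h1 (funext fun i => ?_)
      by_cases hi : i = j
      · rw [hi, e]
      · rw [hγ i hi, hij i hi]
    have h2' : γ j ≠ β j := by
      intro e
      refine h2 (funext fun i => ?_)
      by_cases hi : i = j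
      · rw [hi, e]
      · rw [hγ i hi]
    rw [h j]
    simp [h1', h2']
  · push Not at hγ
    obtain ⟨i, hi, hγi⟩ := hγ
    refine Finset.prod_eq_zero (Finset.mem_univ i) ?_
    rw [h i, hij i hi]
    simp [hγi]

/-- Only an inequality, so as to cover the degenerate edge `α = β`, on which the probability is 1.
-/
lemma OnEdge.le_playProb (h : OnEdge α β y z) (hij : ∀ i, i ≠ j → α i = β i) (hy : 0 ≤ y) :
    1 - y ≤ playProb z β := by
  unfold playProb
  rw [Finset.prod_eq_single j]
  · rw [h j]
    by_cases hj : α j = β j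
    · simp [hj, hy]
    · simp [Ne.symm hj]
  · intro i _ hi
    rw [h i, hij i hi]
    simp
  · simp

lemma playProb_nonneg (z : State A) (α : Profile A) : 0 ≤ playProb z α :=
  Finset.prod_nonneg fun i _ => (z.2.1 i).2.1 _

lemma OnEdge.sum_playProb_mul (h : OnEdge α β y z) (hij : ∀ i, i ≠ j → α i = β i)
    (hj : α j ≠ β j) (f : Profile A → ℝ) :
    ∑ γ, playProb z γ * f γ = (1 - y) * f β + y * f α := by
  have hne : β ≠ α := fun e => hj (by rw [e])
  rw [Finset.sum_eq_add_of_mem β α (Finset.mem_univ _) (Finset.mem_univ _) hne,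
    h.playProb_right hij hj, h.playProb_left hij hj]
  rintro γ - ⟨h1, h2⟩
  rw [h.playProb_other hij h2 h1, zero_mul]

/-- The new aspiration level is a convex combination of the old level and the measured utility, so
the triangle inequality suffices. -/
lemma aspDist_next_le (p : ℝ≥0∞) [Fact (1 ≤ p)] (hG : Admissible G) (γ β : Profile A) (z : State A)
    (υ : Fin n → ℝ) : aspDist p G β (next G z γ υ) ≤ (1 - G.ε * G.ν) * aspDist p G β z
      + G.ε * G.ν * (utilDist p G γ β + ‖(WithLp.toLp p υ : PiLp p fun _ : Fin n => ℝ)‖) := by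
  have h0 : 0 ≤ G.ε * G.ν := (mul_pos hG.ε_pos hG.ν_pos).le
  have h1 : 0 ≤ 1 - G.ε * G.ν := by linarith [hG.step_lt_one]
  have e : (WithLp.toLp p (fun i => (next G z γ υ).2.2.1 i - G.u i β) : PiLp p fun _ : Fin n => ℝ)
      = (1 - G.ε * G.ν) • WithLp.toLp p (fun i => z.2.2.1 i - G.u i β)
        + (G.ε * G.ν) • (WithLp.toLp p (fun i => G.u i γ - G.u i β) + WithLp.toLp p υ) := by
    ext i
    simp [next, measuredUtility]
    ring
  unfold aspDist
  rw [e]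
  refine (norm_add_le _ _).trans ?_
  rw [norm_smul, norm_smul, Real.norm_of_nonneg h0, Real.norm_of_nonneg h1]
  exact add_le_add le_rfl (mul_le_mul_of_nonneg_left (norm_add_le _ _) h0)

lemma aspDist_pureState (p : ℝ≥0∞) [Fact (1 ≤ p)] (G : Params A) (α β : Profile A) :
    aspDist p G β (pureState G α) = utilDist p G α β := rfl

lemma utilDist_self (p : ℝ≥0∞) [Fact (1 ≤ p)] (G : Params A) (α : Profile A) :
    utilDist p G α α = 0 := by
  have : (fun i => G.u i α - G.u i α) = (0 : Fin n → ℝ) := by funext i; simp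
  rw [utilDist, this]
  simp

lemma onEdge_pureState (G : Params A) (α β : Profile A) : OnEdge α β 1 (pureState G α) := by
  intro i b
  simp [pureState, vertex]

end Dynamics

/-! ### The unperturbed process on an edge: invariance, submartingales and geometric absorption. -/

section Chain

variable {n : ℕ} {A : Fin n → Type*} [∀ i, Fintype (A i)] [∀ i, DecidableEq (A i)]
  [∀ i, MeasurableSpace (A i)] [∀ i, MeasurableSingletonClass (A i)]

variable (G : Params A) (N : Measure (Fin n → ℝ)) [IsProbabilityMeasure N]

lemma measurable_next_noise (z : State A) (γ : Profile A) : Measurable fun υ => next G z γ υ :=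
  (measurable_next G γ).comp measurable_prodMk_left

lemma stepKernel_apply (w : State A → Profile A → ℝ) (hw : ∀ α, Measurable fun z => w z α)
    (z : State A) : stepKernel G N w hw z
      = ∑ γ : Profile A, ENNReal.ofReal (w z γ) • N.map (fun υ => next G z γ υ) := rfl

lemma integral_unperturbed {f : State A → ℝ} (hf : IsUnitFun f) (z : State A) :
    ∫ y, f y ∂unperturbed G N z = ∑ γ, playProb z γ * ∫ υ, f (next G z γ υ) ∂N := by
  rw [unperturbed, stepKernel_apply, integral_finsetSum_measure]
  · refine Finset.sum_congr rfl fun γ _ => ?_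
    rw [integral_smul_measure, ENNReal.toReal_ofReal (playProb_nonneg z γ),
      integral_map (measurable_next_noise G z γ).aemeasurable hf.measurable.aestronglyMeasurable,
      smul_eq_mul]
  · intro γ _
    have : IsProbabilityMeasure (N.map fun υ => next G z γ υ) :=
      Measure.isProbabilityMeasure_map (measurable_next_noise G z γ).aemeasurable
    exact (hf.integrable _).smul_measure ENNReal.ofReal_ne_top

lemma ae_unperturbed {S : Set (State A)} (hS : MeasurableSet S) (z : State A)
    (h : ∀ γ, playProb z γ ≠ 0 → ∀ᵐ υ ∂N, next G z γ υ ∈ S) : ∀ᵐ y ∂unperturbed G N z, y ∈ S := by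
  rw [ae_iff, unperturbed, stepKernel_apply, Measure.finsetSum_apply]
  refine Finset.sum_eq_zero fun γ _ => ?_
  by_cases hγ : playProb z γ = 0
  · simp [hγ]
  · have h1 := h γ hγ
    have h2 : N.map (fun υ => next G z γ υ) {y | y ∉ S} = 0 :=
      (ae_map_iff (p := fun y => y ∈ S) (measurable_next_noise G z γ).aemeasurable hS).2 h1
    rw [Measure.smul_apply, h2, smul_zero]

/-- Almost surely the noise is tame and its `ℓ^p` norm is at most `r`. -/
def TameNoise (p : ℝ≥0∞) [Fact (1 ≤ p)] (r : ℝ) : Prop :=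
  ∀ᵐ υ ∂N, TameAt G υ ∧ ‖(WithLp.toLp p υ : PiLp p fun _ : Fin n => ℝ)‖ ≤ r

/-- States in which only one player still mixes, namely between its actions in `α` and `β`, and
the aspiration levels are within `R` of the utilities of both profiles. -/
def edgeSet (p : ℝ≥0∞) [Fact (1 ≤ p)] (α β : Profile A) (R : ℝ) : Set (State A) :=
  {z | (∃ y, OnEdge α β y z) ∧ aspDist p G α z ≤ R ∧ aspDist p G β z ≤ R}

lemma edgeSet_comm (p : ℝ≥0∞) [Fact (1 ≤ p)] (α β : Profile A) (R : ℝ) :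
    edgeSet G p α β R = edgeSet G p β α R := by
  ext z
  exact ⟨fun ⟨⟨y, h⟩, h1, h2⟩ => ⟨⟨_, h.symm⟩, h2, h1⟩, fun ⟨⟨y, h⟩, h1, h2⟩ => ⟨⟨_, h.symm⟩, h2, h1⟩⟩

lemma measurable_aspDist (p : ℝ≥0∞) [Fact (1 ≤ p)] (α : Profile A) :
    Measurable (aspDist p G α) := by
  have hc : Continuous fun v : Fin n → ℝ => ‖(WithLp.toLp p v : PiLp p fun _ : Fin n => ℝ)‖ :=
    continuous_norm.comp (PiLp.continuous_toLp p _)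
  exact hc.measurable.comp (measurable_pi_lambda _ fun i => by fun_prop)

variable {G N} {α β : Profile A} {j : Fin n} {p : ℝ≥0∞} [Fact (1 ≤ p)] {r R : ℝ}

lemma measurableSet_edgeSet (hj : α j ≠ β j) : MeasurableSet (edgeSet G p α β R) := by
  have h1 : {z : State A | ∃ y, OnEdge α β y z} = {z | OnEdge α β ((z.2.1 j).1 (α j)) z} := by
    ext z
    refine ⟨fun ⟨y, h⟩ => ?_, fun h => ⟨_, h⟩⟩
    change OnEdge α β ((z.2.1 j).1 (α j)) z
    rwa [h.eq_apply hj]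
  have h2 : MeasurableSet {z : State A | ∃ y, OnEdge α β y z} := by
    rw [h1]
    simp only [OnEdge, Set.ofPred_forall]
    refine MeasurableSet.iInter fun i => MeasurableSet.iInter fun b => ?_
    exact measurableSet_eq_fun (measurable_coord i b)
      (measurable_const.add ((measurable_coord j (α j)).mul measurable_const))
  exact h2.inter ((measurableSet_le (measurable_aspDist G p α) measurable_const).inter
    (measurableSet_le (measurable_aspDist G p β) measurable_const))

/-- A measured utility of either profile is within `utilDist p G α β + r ≤ R` of the utilities of
both, and balls of radius `R` are convex. -/
lemma next_mem_edgeSet (hG : Admissible G) (hij : ∀ i, i ≠ j → α i = β i)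
    (hR : utilDist p G α β + r ≤ R) {z : State A} (hz : z ∈ edgeSet G p α β R) {υ : Fin n → ℝ}
    (hυ : TameAt G υ) (hυr : ‖(WithLp.toLp p υ : PiLp p fun _ : Fin n => ℝ)‖ ≤ r) :
    next G z β υ ∈ edgeSet G p α β R := by
  obtain ⟨⟨y, hy⟩, h1, h2⟩ := hz
  obtain ⟨θ, -, -, hθ⟩ := hy.next hG hυ hij
  have h0 : 0 ≤ G.ε * G.ν := (mul_pos hG.ε_pos hG.ν_pos).le
  have h0' : 0 ≤ 1 - G.ε * G.ν := by linarith [hG.step_lt_one]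
  have hU : 0 ≤ utilDist p G α β := norm_nonneg _
  refine ⟨⟨_, hθ⟩, ?_, ?_⟩
  · calc _ ≤ _ := aspDist_next_le p hG β α z υ
      _ ≤ (1 - G.ε * G.ν) * R + G.ε * G.ν * R := by
        rw [utilDist_comm]; gcongr; linarith
      _ = R := by ring
  · calc _ ≤ _ := aspDist_next_le p hG β β z υ
      _ ≤ (1 - G.ε * G.ν) * R + G.ε * G.ν * R := by
        rw [utilDist_self]; gcongr; linarith
      _ = R := by ring

lemma next_mem_edgeSet' (hG : Admissible G) (hij : ∀ i, i ≠ j → α i = β i)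
    (hR : utilDist p G α β + r ≤ R) {z : State A} (hz : z ∈ edgeSet G p α β R) {υ : Fin n → ℝ}
    (hυ : TameAt G υ) (hυr : ‖(WithLp.toLp p υ : PiLp p fun _ : Fin n => ℝ)‖ ≤ r) :
    next G z α υ ∈ edgeSet G p α β R := by
  rw [edgeSet_comm] at hz ⊢
  exact next_mem_edgeSet hG (fun i hi => (hij i hi).symm) (by rwa [utilDist_comm]) hz hυ hυr

lemma isAbsorbing_edgeSet (hG : Admissible G) (hN : TameNoise G N p r)
    (hij : ∀ i, i ≠ j → α i = β i) (hj : α j ≠ β j) (hR : utilDist p G α β + r ≤ R) :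
    IsAbsorbing (unperturbed G N) (edgeSet G p α β R) := by
  intro z hz
  refine ae_unperturbed G N (measurableSet_edgeSet hj) z fun γ hγ => ?_
  filter_upwards [hN] with υ hυ
  obtain ⟨⟨y, hy⟩, -⟩ := id hz
  by_cases h1 : γ = α
  · rw [h1]
    exact next_mem_edgeSet' hG hij hR hz hυ.1 hυ.2
  · by_cases h2 : γ = β
    · rw [h2]
      exact next_mem_edgeSet hG hij hR hz hυ.1 hυ.2
    · exact absurd (hy.playProb_other hij h1 h2) hγ

lemma next_pureState_mem_edgeSet (hG : Admissible G) (hij : ∀ i, i ≠ j → α i = β i)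
    (hr : 0 ≤ r) (hR : utilDist p G α β + r ≤ R) {υ : Fin n → ℝ}
    (hυ : TameAt G υ) (hυr : ‖(WithLp.toLp p υ : PiLp p fun _ : Fin n => ℝ)‖ ≤ r) :
    next G (pureState G α) β υ ∈ edgeSet G p α β R := by
  have hU : 0 ≤ utilDist p G α β := norm_nonneg _
  refine next_mem_edgeSet hG hij hR ⟨⟨1, onEdge_pureState G α β⟩, ?_, ?_⟩ hυ hυr
  · rw [aspDist_pureState, utilDist_self]; linarith
  · rw [aspDist_pureState]; linarith

/-- Powers of the probability of an action. -/
def coordPow (j : Fin n) (b : A j) (m : ℕ) (z : State A) : ℝ := (z.2.1 j).1 b ^ m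

lemma coord_le_one (z : State A) (i : Fin n) (b : A i) : (z.2.1 i).1 b ≤ 1 := by
  rw [← (z.2.1 i).2.2]
  exact Finset.single_le_sum (fun b _ => (z.2.1 i).2.1 b) (Finset.mem_univ b)

lemma isUnitFun_coordPow (j : Fin n) (b : A j) (m : ℕ) : IsUnitFun (coordPow (A := A) j b m) :=
  ⟨(measurable_coord j b).pow_const m, fun z => pow_nonneg ((z.2.1 j).2.1 b) m,
    fun z => pow_le_one₀ ((z.2.1 j).2.1 b) (coord_le_one z j b)⟩

lemma isUnitFun_indicator {B : Set (State A)} (hB : MeasurableSet B) :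
    IsUnitFun (B.indicator (1 : State A → ℝ)) :=
  ⟨measurable_one.indicator hB, fun z => Set.indicator_nonneg (by simp) z,
    fun z => Set.indicator_le_self' (by simp) z⟩

/-- The lower bound for the one-step expectation of the power of the probability of `β j`. -/
lemma coordPow_add_le_expect (hG : Admissible G) (hN : TameNoise G N p r)
    (hij : ∀ i, i ≠ j → α i = β i) (hj : α j ≠ β j) {k : ℕ} (hk : 1 ≤ (k + 1) * (G.ε * G.h))
    {z : State A} (hz : z ∈ edgeSet G p α β R) :
    coordPow j (β j) (k + 2) z
        + G.ε * G.h * ((z.2.1 j).1 (β j) ^ (k + 1) * (1 - (z.2.1 j).1 (β j)))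
      ≤ expect (unperturbed G N) (coordPow j (β j) (k + 2)) 1 z := by
  obtain ⟨⟨y, hy⟩, -⟩ := hz
  obtain ⟨hy0, hy1⟩ := hy.mem_Icc hj
  have hx : (z.2.1 j).1 (β j) = 1 - y := hy.eq_apply' hj
  set f : State A → ℝ := coordPow j (β j) (k + 2) with hf
  have hfu : IsUnitFun f := isUnitFun_coordPow j (β j) (k + 2)
  set B := f z + G.ε * G.h * ((z.2.1 j).1 (β j) ^ (k + 1) * (1 - (z.2.1 j).1 (β j))) with hB
  have hBdef : B = (1 - y) ^ (k + 2) + G.ε * G.h * ((1 - y) ^ (k + 1) * (1 - (1 - y))) := by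
    rw [hB, hf, coordPow, hx]
  have hint : ∀ γ, Integrable (fun υ => f (next G z γ υ)) N := fun γ =>
    IsUnitFun.integrable ⟨hfu.measurable.comp (measurable_next_noise G z γ),
      fun υ => hfu.nonneg _, fun υ => hfu.le_one _⟩ N
  have he : expect (unperturbed G N) f 1 z
      = (1 - y) * ∫ υ, f (next G z β υ) ∂N + y * ∫ υ, f (next G z α υ) ∂N := by
    rw [← hy.sum_playProb_mul hij hj fun γ => ∫ υ, f (next G z γ υ) ∂N]
    exact integral_unperturbed G N hfu z
  rw [he]
  -- The branch in which `α` is played is discarded; the branch of `β` alone gives the bound.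
  have h2 : 0 ≤ y * ∫ υ, f (next G z α υ) ∂N :=
    mul_nonneg hy0 (integral_nonneg fun υ => hfu.nonneg _)
  have h1 : B ≤ (1 - y) * ∫ υ, f (next G z β υ) ∂N := by
    rw [← integral_const_mul]
    calc B = ∫ _, B ∂N := by simp
      _ ≤ _ := by
        refine integral_mono_ae (integrable_const _) ((hint β).const_mul _) ?_
        filter_upwards [hN] with υ hυ
        obtain ⟨θ, hθ, -, h⟩ := hy.next hG hυ.1 hij
        have := pow_add_le_mul_pow (x := 1 - y) (by linarith) (by linarith) hk hθ
        rw [hBdef]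
        refine this.trans (le_of_eq ?_)
        simp only [hf, coordPow]
        rw [h.eq_apply' hj]
        ring
  linarith

lemma coordPow_le_expect (hG : Admissible G) (hN : TameNoise G N p r)
    (hij : ∀ i, i ≠ j → α i = β i) (hj : α j ≠ β j) {k : ℕ} (hk : 1 ≤ (k + 1) * (G.ε * G.h))
    {z : State A} (hz : z ∈ edgeSet G p α β R) :
    coordPow j (β j) (k + 2) z ≤ expect (unperturbed G N) (coordPow j (β j) (k + 2)) 1 z := by
  have h := coordPow_add_le_expect hG hN hij hj hk hz
  have h1 : 0 ≤ (z.2.1 j).1 (β j) ^ (k + 1) * (1 - (z.2.1 j).1 (β j)) :=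
    mul_nonneg (pow_nonneg ((z.2.1 j).2.1 _) _) (sub_nonneg.2 (coord_le_one z j _))
  have := mul_nonneg (mul_pos hG.ε_pos hG.h_pos).le h1
  linarith

lemma TameNoise.step_le_one (hG : Admissible G) (hN : TameNoise G N p r) (γ : Profile A)
    (i : Fin n) : G.ε * G.h ≤ 1 := by
  obtain ⟨υ, hυ, -⟩ := hN.exists
  exact (mul_le_mul_of_nonneg_left (hυ i γ).1 hG.ε_pos.le).trans (hυ i γ).2

lemma TameNoise.radius_nonneg (hN : TameNoise G N p r) : 0 ≤ r := by
  obtain ⟨υ, -, hυ⟩ := hN.exists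
  exact (norm_nonneg _).trans hυ

lemma isUnitFun_sum_coordPow (hj : α j ≠ β j) (k : ℕ) :
    IsUnitFun fun z : State A => coordPow j (β j) (k + 2) z + coordPow j (α j) (k + 2) z := by
  have hβ := isUnitFun_coordPow (A := A) j (β j) (k + 2)
  have hα := isUnitFun_coordPow (A := A) j (α j) (k + 2)
  refine ⟨hβ.measurable.add hα.measurable, fun z => add_nonneg (hβ.nonneg z) (hα.nonneg z),
    fun z => ?_⟩
  have h1 : ∀ b, coordPow j b (k + 2) z ≤ (z.2.1 j).1 b := fun b =>
    pow_le_of_le_one ((z.2.1 j).2.1 b) (coord_le_one z j b) (by omega)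
  have h2 : (z.2.1 j).1 (β j) + (z.2.1 j).1 (α j) ≤ 1 := by
    rw [← (z.2.1 j).2.2, ← Finset.sum_pair hj.symm (f := fun b => (z.2.1 j).1 b)]
    exact Finset.sum_le_sum_of_subset_of_nonneg (Finset.subset_univ _)
      fun b _ _ => (z.2.1 j).2.1 b
  exact (add_le_add (h1 _) (h1 _)).trans h2

/-- The chain is absorbed in the end points of the edge geometrically fast, uniformly in the initial
state. -/
lemma one_sub_rate_pow_le (hG : Admissible G) (hN : TameNoise G N p r)
    (hij : ∀ i, i ≠ j → α i = β i) (hj : α j ≠ β j) (hR : utilDist p G α β + r ≤ R)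
    {k : ℕ} (hk : 1 ≤ (k + 1) * (G.ε * G.h)) (t : ℕ) :
    ∀ z ∈ edgeSet G p α β R, 1 - (1 - lyapunovRate (G.ε * G.h) k) ^ t
      ≤ expect (unperturbed G N) (coordPow j (β j) (k + 2)) t z
        + expect (unperturbed G N) (coordPow j (α j) (k + 2)) t z := by
  have hη := mul_pos hG.ε_pos hG.h_pos
  have hS := isAbsorbing_edgeSet hG hN hij hj hR
  set c := lyapunovRate (G.ε * G.h) k with hc
  have hc1 : 0 ≤ 1 - c := sub_nonneg.2
    (lyapunovRate_le_one hη.le (hN.step_le_one hG α j) k)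
  have hβ := isUnitFun_coordPow (A := A) j (β j) (k + 2)
  have hα := isUnitFun_coordPow (A := A) j (α j) (k + 2)
  set Φ : State A → ℝ := fun z => coordPow j (β j) (k + 2) z + coordPow j (α j) (k + 2) z with hΦ
  have hΦu : IsUnitFun Φ := isUnitFun_sum_coordPow hj k
  have hΨu : IsUnitFun fun z => 1 - Φ z := ⟨measurable_const.sub hΦu.measurable,
    fun z => sub_nonneg.2 (hΦu.le_one z), fun z => sub_le_self _ (hΦu.nonneg z)⟩
  -- The drifts towards both end points are added, so that the defect `1 - Φ` shrinks by the factor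
  -- `1 - c` in the mean.
  have hone : ∀ z ∈ edgeSet G p α β R, Φ z + c * (1 - Φ z) ≤ expect (unperturbed G N) Φ 1 z := by
    intro z hz
    have h1 := coordPow_add_le_expect hG hN hij hj hk hz
    have h2 := coordPow_add_le_expect hG hN (fun i hi => (hij i hi).symm) hj.symm hk
      (edgeSet_comm G p α β R ▸ hz)
    rw [hΦ, expect_add _ hβ hα]
    obtain ⟨⟨y, hy⟩, -⟩ := hz
    obtain ⟨hy0, hy1⟩ := hy.mem_Icc hj
    have h3 := lyapunovRate_mul_le (x := y) k hy0 hy1 hη.le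
    rw [← hc] at h3
    simp only [coordPow, hy.eq_apply hj, hy.eq_apply' hj] at h1 h2 ⊢
    rw [sub_sub_cancel] at h1
    linarith
  intro z hz
  rw [← expect_add _ hβ hα]
  change _ ≤ expect (unperturbed G N) Φ t z
  induction t with
  | zero =>
    simp only [pow_zero, sub_self]
    exact hΦu.nonneg z
  | succ t ih =>
    have h1 := expect_add_le hΦu hΨu hS hone t z hz
    have h2 := expect_add (unperturbed G N) hΦu hΨu t z
    simp only [add_sub_cancel, expect_const] at h2
    have h3 : (1 - c) * (1 - (1 - c) ^ t) ≤ (1 - c) * expect (unperturbed G N) Φ t z :=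
      mul_le_mul_of_nonneg_left ih hc1
    have h4 : 1 - (1 - c) ^ (t + 1) = c + (1 - c) * (1 - (1 - c) ^ t) := by ring
    have h5 : expect (unperturbed G N) (fun z => 1 - Φ z) t z
        = 1 - expect (unperturbed G N) Φ t z := by linarith
    rw [h5] at h1
    linarith

end Chain

/-! ### Absorption probabilities, limits of neighborhood probabilities and hitting probabilities. -/

section Limits

variable {n : ℕ} {A : Fin n → Type*} [∀ i, Fintype (A i)] [∀ i, DecidableEq (A i)]
  [∀ i, MeasurableSpace (A i)] [∀ i, MeasurableSingletonClass (A i)]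

/-- The `ℓ^p` distance between two profiles of pure strategies. -/
def vertexDist (p : ℝ≥0∞) [Fact (1 ≤ p)] (α β : Profile A) : ℝ :=
  ‖(WithLp.toLp p fun i => WithLp.toLp p ((Pi.single (α i) 1 : A i → ℝ) - Pi.single (β i) 1) :
      PiLp p fun i => PiLp p fun _ : A i => ℝ)‖

/-- The `ℓ^p` distance of the strategies in `z` from a profile of pure strategies. -/
def strategyDist (p : ℝ≥0∞) [Fact (1 ≤ p)] (β : Profile A) (z : State A) : ℝ :=
  ‖(WithLp.toLp p fun i => WithLp.toLp p ((z.2.1 i).1 - (vertex (β i)).1) :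
      PiLp p fun i => PiLp p fun _ : A i => ℝ)‖

variable {G : Params A} {N : Measure (Fin n → ℝ)} [IsProbabilityMeasure N]
  {α β : Profile A} {j : Fin n} {p : ℝ≥0∞} [Fact (1 ≤ p)] {r R δ : ℝ} {k : ℕ}

lemma mem_nhd_iff {z : State A} :
    z ∈ nhd p G δ β ↔ z.1 = β ∧ strategyDist p β z < δ ∧ aspDist p G β z < δ := Iff.rfl

lemma OnEdge.strategyDist_eq {y : ℝ} {z : State A} (h : OnEdge α β y z) (hy : 0 ≤ y) :
    strategyDist p β z = y * vertexDist p α β := by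
  have e : (WithLp.toLp p fun i => WithLp.toLp p ((z.2.1 i).1 - (vertex (β i)).1) :
      PiLp p fun i => PiLp p fun _ : A i => ℝ) = y • (WithLp.toLp p fun i =>
        WithLp.toLp p ((Pi.single (α i) 1 : A i → ℝ) - Pi.single (β i) 1)) := by
    ext i b
    simp only [PiLp.smul_apply, Pi.sub_apply, vertex, smul_eq_mul]
    rw [h i b]
    ring
  unfold strategyDist vertexDist
  rw [e, norm_smul, Real.norm_of_nonneg hy]

lemma abs_coord_sub_le_strategyDist (z : State A) (i : Fin n) (b : A i) :
    |(z.2.1 i).1 b - (Pi.single (β i) 1 : A i → ℝ) b| ≤ strategyDist p β z := by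
  have h1 := PiLp.norm_apply_le (WithLp.toLp p fun i =>
    WithLp.toLp p ((z.2.1 i).1 - (vertex (β i)).1) : PiLp p fun i => PiLp p fun _ : A i => ℝ) i
  have h2 := PiLp.norm_apply_le
    (WithLp.toLp p ((z.2.1 i).1 - (vertex (β i)).1) : PiLp p fun _ : A i => ℝ) b
  exact h2.trans h1

lemma measurableSet_nhd : MeasurableSet (nhd p G δ β) := by
  have hc : Continuous fun v : ∀ i, A i → ℝ => ‖(WithLp.toLp p fun i => WithLp.toLp p (v i) :
      PiLp p fun i => PiLp p fun _ : A i => ℝ)‖ := by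
    refine continuous_norm.comp ((PiLp.continuous_toLp p _).comp (continuous_pi fun i => ?_))
    exact (PiLp.continuous_toLp p _).comp (continuous_apply i)
  have hs : Measurable (strategyDist p β) := by
    refine hc.measurable.comp (measurable_pi_lambda _ fun i => measurable_pi_lambda _ fun b => ?_)
    exact (measurable_coord i b).sub measurable_const
  have h1 : MeasurableSet {z : State A | z.1 = β} := measurable_fst (measurableSet_singleton β)
  exact h1.inter ((measurableSet_lt hs measurable_const).inter
    (measurableSet_lt (measurable_aspDist G p β) measurable_const))

/-- The probability to be close to the pure strategy state of `β` after `m` steps is at least the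
probability of playing `β` all the time. -/
lemma pow_le_expect_nhd (hG : Admissible G) (hN : TameNoise G N p r)
    (hij : ∀ i, i ≠ j → α i = β i) (hk : 1 ≤ (k + 1) * (G.ε * G.h)) (m : ℕ) :
    ∀ (z : State A) (y a : ℝ), OnEdge α β y z → 0 ≤ y → y ≤ 1 → (m = 0 → z.1 = β) →
      (1 - G.ε * G.h) ^ m * (y * vertexDist p α β) < δ →
      aspDist p G β z ≤ a + r → (1 - G.ε * G.ν) ^ m * a + r < δ →
      (1 - y) ^ (k + 2) ≤ expect (unperturbed G N) ((nhd p G δ β).indicator 1) m z := by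
  have hu := isUnitFun_indicator (measurableSet_nhd (p := p) (G := G) (δ := δ) (β := β))
  induction m with
  | zero =>
    intro z y a hz hy0 hy1 h0 h1 h2 h3
    have hmem : z ∈ nhd p G δ β := by
      rw [mem_nhd_iff, hz.strategyDist_eq hy0]
      exact ⟨h0 rfl, by simpa using h1, h2.trans_lt (by simpa using h3)⟩
    simp only [expect, Set.indicator_of_mem hmem, Pi.one_apply]
    exact pow_le_one₀ (by linarith) (by linarith)
  | succ m ih =>
    intro z y a hz hy0 hy1 _ h1 h2 h3
    set f := expect (unperturbed G N) ((nhd p G δ β).indicator 1) m with hf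
    have hfu : IsUnitFun f := hu.expect m
    have hD : 0 ≤ vertexDist p α β := norm_nonneg _
    have hη := hN.step_le_one hG α j
    have hint : Integrable (fun υ => f (next G z β υ)) N :=
      IsUnitFun.integrable ⟨hfu.measurable.comp (measurable_next_noise G z β),
        fun υ => hfu.nonneg _, fun υ => hfu.le_one _⟩ N
    have e : expect (unperturbed G N) ((nhd p G δ β).indicator 1) (m + 1) z
        = ∑ γ, playProb z γ * ∫ υ, f (next G z γ υ) ∂N := integral_unperturbed G N hfu z
    rw [e]
    have hpos : ∀ γ, 0 ≤ ∫ υ, f (next G z γ υ) ∂N := fun γ => integral_nonneg fun υ => hfu.nonneg _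
    refine le_trans ?_ (Finset.single_le_sum
      (f := fun γ => playProb z γ * ∫ υ, f (next G z γ υ) ∂N)
      (fun γ _ => mul_nonneg (playProb_nonneg z γ) (hpos γ)) (Finset.mem_univ β))
    refine le_trans ?_ (mul_le_mul_of_nonneg_right (hz.le_playProb hij hy0) (hpos β))
    rw [← integral_const_mul]
    calc (1 - y) ^ (k + 2) = ∫ _, (1 - y) ^ (k + 2) ∂N := by simp
      _ ≤ _ := by
        refine integral_mono_ae (integrable_const _) (hint.const_mul _) ?_
        filter_upwards [hN] with υ hυ
        obtain ⟨θ, hθ, hθ1, h⟩ := hz.next hG hυ.1 hij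
        have hle : (1 - θ) * y ≤ (1 - G.ε * G.h) * y :=
          mul_le_mul_of_nonneg_right (by linarith) hy0
        have hy' : (1 - θ) * y ≤ 1 := by
          have := mul_pos hG.ε_pos hG.h_pos
          nlinarith
        -- The aspiration error splits into `a`, which contracts, and a noise part that never
        -- exceeds `r`. After one play of `β` the recorded profile is `β`, which settles the clause
        -- for `m = 0`.
        have hi := ih (next G z β υ) ((1 - θ) * y) ((1 - G.ε * G.ν) * a) h
          (mul_nonneg (by linarith) hy0) hy' (fun _ => rfl) ?_ ?_ ?_
        · have h5 := pow_add_le_mul_pow (x := 1 - y) (by linarith) (by linarith) hk hθ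
          have h6 : 0 ≤ G.ε * G.h * ((1 - y) ^ (k + 1) * (1 - (1 - y))) := by
            have := (mul_pos hG.ε_pos hG.h_pos).le
            have h7 : 0 ≤ 1 - y := by linarith
            rw [sub_sub_cancel]
            positivity
          have h8 : (1 - y) * (1 - (1 - θ) * y) ^ (k + 2) ≤ (1 - y) * f (next G z β υ) :=
            mul_le_mul_of_nonneg_left hi (by linarith)
          rw [show 1 - y + θ * (1 - (1 - y)) = 1 - (1 - θ) * y by ring] at h5
          change (1 - y) ^ (k + 2) ≤ (1 - y) * f (next G z β υ)
          linarith
        · refine lt_of_le_of_lt ?_ h1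
          rw [pow_succ, mul_assoc ((1 - G.ε * G.h) ^ m)]
          refine mul_le_mul_of_nonneg_left ?_ (pow_nonneg (sub_nonneg.2 hη) m)
          rw [← mul_assoc]
          exact mul_le_mul_of_nonneg_right hle hD
        · have h9 := aspDist_next_le p hG β β z υ
          rw [utilDist_self] at h9
          have h10 : (1 - G.ε * G.ν) * aspDist p G β z ≤ (1 - G.ε * G.ν) * (a + r) :=
            mul_le_mul_of_nonneg_left h2 (by linarith [hG.step_lt_one])
          have h11 : G.ε * G.ν * (0 + ‖(WithLp.toLp p υ : PiLp p fun _ : Fin n => ℝ)‖)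
              ≤ G.ε * G.ν * r :=
            mul_le_mul_of_nonneg_left (by linarith [hυ.2]) (mul_pos hG.ε_pos hG.ν_pos).le
          linarith
        · rw [← mul_assoc, ← pow_succ]
          exact h3

/-- One `m` serves all states of the edge, because strategy and aspiration distances are bounded
there and contract geometrically, the latter down to `r < δ`. -/
lemma exists_coordPow_le_expect_nhd (hG : Admissible G) (hN : TameNoise G N p r)
    (hij : ∀ i, i ≠ j → α i = β i) (hj : α j ≠ β j) (hk : 1 ≤ (k + 1) * (G.ε * G.h))
    (hr : r < δ) :
    ∃ m, ∀ z ∈ edgeSet G p α β R, coordPow j (β j) (k + 2) z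
      ≤ expect (unperturbed G N) ((nhd p G δ β).indicator 1) m z := by
  have hη := hN.step_le_one hG α j
  have hη0 := mul_pos hG.ε_pos hG.h_pos
  have hν0 := mul_pos hG.ε_pos hG.ν_pos
  have hν1 := hG.step_lt_one
  have hr0 := hN.radius_nonneg
  have hD : 0 ≤ vertexDist p α β := norm_nonneg _
  have t1 : Tendsto (fun m : ℕ => (1 - G.ε * G.h) ^ m * vertexDist p α β) atTop (𝓝 0) := by
    simpa using (tendsto_pow_atTop_nhds_zero_of_lt_one (by linarith) (by linarith)).mul_const
      (vertexDist p α β)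
  have t2 : Tendsto (fun m : ℕ => (1 - G.ε * G.ν) ^ m * R + r) atTop (𝓝 r) := by
    simpa using ((tendsto_pow_atTop_nhds_zero_of_lt_one (r := 1 - G.ε * G.ν)
      (by linarith) (by linarith)).mul_const R).add_const r
  -- Taking `m` positive makes the initially recorded profile irrelevant.
  obtain ⟨m, h1, h2, h3⟩ := ((t1.eventually_lt_const (hr0.trans_lt hr)).and
    ((t2.eventually_lt_const hr).and (eventually_gt_atTop 0))).exists
  refine ⟨m, fun z hz => ?_⟩
  obtain ⟨⟨y, hy⟩, -, ha⟩ := hz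
  obtain ⟨hy0, hy1⟩ := hy.mem_Icc hj
  rw [coordPow, hy.eq_apply' hj]
  refine pow_le_expect_nhd hG hN hij hk m z y R hy hy0 hy1 (fun h => absurd h h3.ne') ?_
    (by linarith) h2
  refine lt_of_le_of_lt ?_ h1
  refine mul_le_mul_of_nonneg_left ?_ (pow_nonneg (by linarith) m)
  nlinarith

variable (G N) in
/-- The expectation of `f` after `t` unperturbed steps that follow a trembling from the pure strategy
state of `α` in which `β` is played. -/
def startMean (α β : Profile A) (f : State A → ℝ) (t : ℕ) : ℝ :=
  ∫ υ, expect (unperturbed G N) f t (next G (pureState G α) β υ) ∂N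

lemma IsUnitFun.integrable_next {f : State A → ℝ} (hf : IsUnitFun f) (z : State A) (β : Profile A) :
    Integrable (fun υ => f (APLA.next G z β υ)) N :=
  IsUnitFun.integrable ⟨hf.measurable.comp (measurable_next_noise G z β),
    fun _ => hf.nonneg _, fun _ => hf.le_one _⟩ N

lemma startMean_nonneg {f : State A → ℝ} (hf : IsUnitFun f) (t : ℕ) : 0 ≤ startMean G N α β f t :=
  integral_nonneg fun _ => (hf.expect t).nonneg _

lemma startMean_le_one {f : State A → ℝ} (hf : IsUnitFun f) (t : ℕ) :
    startMean G N α β f t ≤ 1 := by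
  calc _ ≤ ∫ _, (1 : ℝ) ∂N :=
        integral_mono ((hf.expect t).integrable_next _ _) (integrable_const _)
          fun _ => (hf.expect t).le_one _
    _ = 1 := by simp

lemma startMean_add {f g : State A → ℝ} (hf : IsUnitFun f) (hg : IsUnitFun g) (t : ℕ) :
    startMean G N α β (fun z => f z + g z) t
      = startMean G N α β f t + startMean G N α β g t := by
  unfold startMean
  rw [← integral_add ((hf.expect t).integrable_next _ _) ((hg.expect t).integrable_next _ _)]
  exact integral_congr_ae (ae_of_all _ fun υ => expect_add _ hf hg t _)

lemma ae_next_mem_edgeSet (hG : Admissible G) (hN : TameNoise G N p r)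
    (hij : ∀ i, i ≠ j → α i = β i) :
    ∀ᵐ υ ∂N, next G (pureState G α) β υ ∈ edgeSet G p α β (utilDist p G α β + r) := by
  filter_upwards [hN] with υ hυ
  exact next_pureState_mem_edgeSet hG hij hN.radius_nonneg le_rfl hυ.1 hυ.2

lemma startMean_le_of_le (hG : Admissible G) (hN : TameNoise G N p r)
    (hij : ∀ i, i ≠ j → α i = β i) {f g : State A → ℝ} (hf : IsUnitFun f) (hg : IsUnitFun g)
    {s t : ℕ} (h : ∀ z ∈ edgeSet G p α β (utilDist p G α β + r),
      expect (unperturbed G N) f s z ≤ expect (unperturbed G N) g t z) :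
    startMean G N α β f s ≤ startMean G N α β g t := by
  refine integral_mono_ae ((hf.expect s).integrable_next _ _) ((hg.expect t).integrable_next _ _) ?_
  filter_upwards [ae_next_mem_edgeSet hG hN hij] with υ hυ using h _ hυ

lemma monotone_startMean (hG : Admissible G) (hN : TameNoise G N p r)
    (hij : ∀ i, i ≠ j → α i = β i) (hj : α j ≠ β j) (hk : 1 ≤ (k + 1) * (G.ε * G.h)) :
    Monotone (startMean G N α β (coordPow j (β j) (k + 2))) ∧
      Monotone (startMean G N α β (coordPow j (α j) (k + 2))) := by
  have hS := isAbsorbing_edgeSet hG hN hij hj (le_refl (utilDist p G α β + r))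
  constructor
  · exact monotone_nat_of_le_succ fun t => startMean_le_of_le hG hN hij (isUnitFun_coordPow _ _ _)
      (isUnitFun_coordPow _ _ _) fun z hz => expect_le_succ (isUnitFun_coordPow _ _ _) hS
        (fun z hz => coordPow_le_expect hG hN hij hj hk hz) t hz
  · exact monotone_nat_of_le_succ fun t => startMean_le_of_le hG hN hij (isUnitFun_coordPow _ _ _)
      (isUnitFun_coordPow _ _ _) fun z hz => expect_le_succ (isUnitFun_coordPow _ _ _) hS
        (fun z hz => coordPow_le_expect hG hN (fun i hi => (hij i hi).symm) hj.symm hk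
          (edgeSet_comm G p α β _ ▸ hz)) t hz

lemma startMean_add_le_one (hj : α j ≠ β j) (t : ℕ) :
    startMean G N α β (coordPow j (β j) (k + 2)) t
      + startMean G N α β (coordPow j (α j) (k + 2)) t ≤ 1 := by
  rw [← startMean_add (isUnitFun_coordPow _ _ _) (isUnitFun_coordPow _ _ _)]
  exact startMean_le_one (isUnitFun_sum_coordPow hj k) t

lemma one_sub_le_startMean_add (hG : Admissible G) (hN : TameNoise G N p r)
    (hij : ∀ i, i ≠ j → α i = β i) (hj : α j ≠ β j) (hk : 1 ≤ (k + 1) * (G.ε * G.h)) (t : ℕ) :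
    1 - (1 - lyapunovRate (G.ε * G.h) k) ^ t ≤ startMean G N α β (coordPow j (β j) (k + 2)) t
      + startMean G N α β (coordPow j (α j) (k + 2)) t := by
  have h1 := ((isUnitFun_coordPow (A := A) j (β j) (k + 2)).expect
    (κ := unperturbed G N) t).integrable_next (N := N) (G := G) (pureState G α) β
  have h2 := ((isUnitFun_coordPow (A := A) j (α j) (k + 2)).expect
    (κ := unperturbed G N) t).integrable_next (N := N) (G := G) (pureState G α) β
  rw [startMean, startMean, ← integral_add h1 h2]
  calc _ = ∫ _, (1 - (1 - lyapunovRate (G.ε * G.h) k) ^ t) ∂N := by simp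
    _ ≤ _ := by
      refine integral_mono_ae (integrable_const _) (h1.add h2) ?_
      filter_upwards [ae_next_mem_edgeSet hG hN hij] with υ hυ
      exact one_sub_rate_pow_le hG hN hij hj le_rfl hk t _ hυ

variable (G N) in
/-- The probability of absorption in `β` after a trembling of player `j` from `α` to `β`. -/
def absorbProb (j : Fin n) (k : ℕ) (α β : Profile A) : ℝ :=
  ⨆ t, startMean G N α β (coordPow j (β j) (k + 2)) t

lemma startMean_le_absorbProb (t : ℕ) :
    startMean G N α β (coordPow j (β j) (k + 2)) t ≤ absorbProb G N j k α β :=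
  le_ciSup (f := startMean G N α β (coordPow j (β j) (k + 2))) ⟨1, by
    rintro _ ⟨t, rfl⟩
    exact startMean_le_one (isUnitFun_coordPow _ _ _) t⟩ t

lemma absorbProb_nonneg : 0 ≤ absorbProb G N j k α β :=
  (startMean_nonneg (isUnitFun_coordPow _ _ _) 0).trans (startMean_le_absorbProb 0)

lemma absorbProb_le_one : absorbProb G N j k α β ≤ 1 :=
  ciSup_le fun t => startMean_le_one (isUnitFun_coordPow _ _ _) t

/-- Both means increase, and their sum lies between `1 - (1 - c) ^ t` and 1, with `c` the Lyapunov
rate. So neither can grow by more than `(1 - c) ^ t` after time `t`. This error does not depend on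
the noise law. -/
lemma absorbProb_le_startMean_add (hG : Admissible G) (hN : TameNoise G N p r)
    (hij : ∀ i, i ≠ j → α i = β i) (hj : α j ≠ β j) (hk : 1 ≤ (k + 1) * (G.ε * G.h)) (t : ℕ) :
    absorbProb G N j k α β ≤ startMean G N α β (coordPow j (β j) (k + 2)) t
      + (1 - lyapunovRate (G.ε * G.h) k) ^ t := by
  obtain ⟨h1, h2⟩ := monotone_startMean hG hN hij hj hk
  refine ciSup_le fun s => ?_
  have h3 := h1 (le_max_left s t)
  have h4 := h2 (le_max_right s t)
  have h5 := startMean_add_le_one (G := G) (N := N) (k := k) hj (max s t)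
  have h6 := one_sub_le_startMean_add hG hN hij hj hk t
  linarith

lemma tendsto_rate_pow (hG : Admissible G) (hN : TameNoise G N p r) (α : Profile A) (j : Fin n)
    (k : ℕ) : Tendsto (fun t : ℕ => (1 - lyapunovRate (G.ε * G.h) k) ^ t) atTop (𝓝 0) := by
  have h0 := mul_pos hG.ε_pos hG.h_pos
  have h1 := lyapunovRate_pos h0 k
  have h2 := lyapunovRate_le_one h0.le (hN.step_le_one hG α j) k
  exact tendsto_pow_atTop_nhds_zero_of_lt_one (by linarith) (by linarith)

lemma tendsto_startMean (hG : Admissible G) (hN : TameNoise G N p r)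
    (hij : ∀ i, i ≠ j → α i = β i) (hj : α j ≠ β j) (hk : 1 ≤ (k + 1) * (G.ε * G.h)) :
    Tendsto (startMean G N α β (coordPow j (β j) (k + 2))) atTop (𝓝 (absorbProb G N j k α β)) :=
  tendsto_atTop_ciSup (monotone_startMean hG hN hij hj hk).1 ⟨1, by
    rintro _ ⟨t, rfl⟩
    exact startMean_le_one (isUnitFun_coordPow _ _ _) t⟩

/-- Neighborhoods of different pure states are disjoint for every `δ`, because they record the
action profile. -/
lemma sum_startMean_nhd_le_one (s : Finset (Profile A)) (t : ℕ) :
    ∑ γ ∈ s, startMean G N α β ((nhd p G δ γ).indicator 1) t ≤ 1 := by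
  have hu := fun γ => isUnitFun_indicator (measurableSet_nhd (p := p) (G := G) (δ := δ) (β := γ))
  have hun : ∀ s : Finset (Profile A), ∀ z : State A,
      ∑ γ ∈ s, (nhd p G δ γ).indicator (1 : State A → ℝ) z ≤ 1 := by
    intro s z
    by_cases hz : z.1 ∈ s
    · rw [Finset.sum_eq_single_of_mem z.1 hz]
      · exact (hu z.1).le_one z
      · intro γ _ hγ
        exact Set.indicator_of_notMem (fun h => hγ h.1.symm) _
    · rw [Finset.sum_eq_zero]
      · exact zero_le_one
      · intro γ hγ
        refine Set.indicator_of_notMem (fun h => hz ?_) _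
        rw [h.1]; exact hγ
  have hsu : ∀ s : Finset (Profile A),
      IsUnitFun fun z : State A => ∑ γ ∈ s, (nhd p G δ γ).indicator (1 : State A → ℝ) z :=
    fun s => ⟨Finset.measurable_sum _ fun γ _ => (hu γ).measurable,
      fun z => Finset.sum_nonneg fun γ _ => (hu γ).nonneg z, hun s⟩
  have key : ∀ s : Finset (Profile A), ∑ γ ∈ s, startMean G N α β ((nhd p G δ γ).indicator 1) t
      = startMean G N α β (fun z => ∑ γ ∈ s, (nhd p G δ γ).indicator (1 : State A → ℝ) z) t := by
    intro s
    induction s using Finset.induction_on with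
    | empty => simp [startMean, expect_const]
    | insert γ s hγ ih =>
      rw [Finset.sum_insert hγ, ih, ← startMean_add (hu γ) (hsu s)]
      simp only [Finset.sum_insert hγ]
  rw [key]
  exact startMean_le_one (hsu s) t

lemma exists_startMean_le_nhd (hG : Admissible G) (hN : TameNoise G N p r)
    (hij : ∀ i, i ≠ j → α i = β i) (hj : α j ≠ β j) (hk : 1 ≤ (k + 1) * (G.ε * G.h)) (hr : r < δ) :
    ∃ m, ∀ t,
      startMean G N α β (coordPow j (β j) (k + 2)) t
        ≤ startMean G N α β ((nhd p G δ β).indicator 1) (t + m) ∧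
      startMean G N α β (coordPow j (α j) (k + 2)) t
        ≤ startMean G N α β ((nhd p G δ α).indicator 1) (t + m) := by
  have hu := fun γ => isUnitFun_indicator (measurableSet_nhd (p := p) (G := G) (δ := δ) (β := γ))
  have hS := isAbsorbing_edgeSet hG hN hij hj (le_refl (utilDist p G α β + r))
  obtain ⟨m₁, h₁⟩ := exists_coordPow_le_expect_nhd
    (R := utilDist p G α β + r) hG hN hij hj hk hr
  obtain ⟨m₂, h₂⟩ := exists_coordPow_le_expect_nhd
    (R := utilDist p G α β + r) hG hN (fun i hi => (hij i hi).symm) hj.symm hk hr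
  rw [edgeSet_comm] at h₂
  obtain ⟨mono₁, mono₂⟩ := monotone_startMean hG hN hij hj hk
  -- A common delay for both ends: the surplus steps are absorbed by monotonicity of the means.
  refine ⟨m₁ + m₂, fun t => ⟨?_, ?_⟩⟩
  · refine (mono₁ (Nat.le_add_right t m₂)).trans ?_
    rw [show t + (m₁ + m₂) = t + m₂ + m₁ by ring]
    refine startMean_le_of_le hG hN hij (isUnitFun_coordPow _ _ _) (hu β) fun z hz => ?_
    rw [expect_add_time _ m₁]
    exact expect_mono (isUnitFun_coordPow _ _ _) ((hu β).expect m₁) hS h₁ _ z hz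
  · refine (mono₂ (Nat.le_add_right t m₁)).trans ?_
    rw [← add_assoc]
    refine startMean_le_of_le hG hN hij (isUnitFun_coordPow _ _ _) (hu α) fun z hz => ?_
    rw [expect_add_time _ m₂]
    exact expect_mono (isUnitFun_coordPow _ _ _) ((hu α).expect m₂) hS h₂ _ z hz

/-- Each neighborhood probability has the mean of its power as a delayed lower bound. The two
probabilities sum to at most 1 while the lower bounds sum to nearly 1, so both are squeezed. -/
lemma tendsto_startMean_nhd (hG : Admissible G) (hN : TameNoise G N p r)
    (hij : ∀ i, i ≠ j → α i = β i) (hj : α j ≠ β j) (hk : 1 ≤ (k + 1) * (G.ε * G.h)) (hr : r < δ) :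
    Tendsto (startMean G N α β ((nhd p G δ β).indicator 1)) atTop
        (𝓝 (absorbProb G N j k α β)) ∧
      Tendsto (startMean G N α β ((nhd p G δ α).indicator 1)) atTop
        (𝓝 (1 - absorbProb G N j k α β)) := by
  have hne : β ≠ α := fun e => hj (by rw [e])
  obtain ⟨m, hm⟩ := exists_startMean_le_nhd hG hN hij hj hk hr
  have hlim := tendsto_startMean hG hN hij hj hk
  have hrate := tendsto_rate_pow hG hN α j k
  have hdis : ∀ t, startMean G N α β ((nhd p G δ β).indicator 1) t
      + startMean G N α β ((nhd p G δ α).indicator 1) t ≤ 1 := fun t => by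
    have := sum_startMean_nhd_le_one (G := G) (N := N) (α := α) (β := β) (p := p) (δ := δ) {β, α} t
    rwa [Finset.sum_pair hne] at this
  have hsum := one_sub_le_startMean_add hG hN hij hj hk
  constructor
  · refine (tendsto_add_atTop_iff_nat m).1 ?_
    refine tendsto_of_tendsto_of_tendsto_of_le_of_le hlim (by simpa using hlim.add hrate)
      (fun t => (hm t).1) fun t => ?_
    have := hdis (t + m)
    have := (hm t).2
    have := hsum t
    simp only
    linarith
  · refine (tendsto_add_atTop_iff_nat m).1 ?_
    refine tendsto_of_tendsto_of_tendsto_of_le_of_le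
      (by simpa using (hlim.const_sub 1).sub hrate) (hlim.const_sub 1) (fun t => ?_) fun t => ?_
    · have := (hm t).2
      have := hsum t
      simp only
      linarith
    · have := hdis (t + m)
      have := (hm t).1
      simp only
      linarith

lemma tendsto_startMean_nhd_other (hG : Admissible G) (hN : TameNoise G N p r)
    (hij : ∀ i, i ≠ j → α i = β i) (hj : α j ≠ β j) (hk : 1 ≤ (k + 1) * (G.ε * G.h)) (hr : r < δ)
    {γ : Profile A} (h1 : γ ≠ α) (h2 : γ ≠ β) :
    Tendsto (startMean G N α β ((nhd p G δ γ).indicator 1)) atTop (𝓝 0) := by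
  have hne : β ≠ α := fun e => hj (by rw [e])
  obtain ⟨hβ, hα⟩ := tendsto_startMean_nhd hG hN hij hj hk hr
  have hu := isUnitFun_indicator (measurableSet_nhd (p := p) (G := G) (δ := δ) (β := γ))
  have h0 := (hβ.add hα).const_sub 1
  rw [add_sub_cancel, sub_self] at h0
  refine squeeze_zero (fun t => startMean_nonneg hu t) (fun t => ?_) h0
  have := sum_startMean_nhd_le_one (G := G) (N := N) (α := α) (β := β) (p := p) (δ := δ)
    {γ, β, α} t
  rw [Finset.sum_insert (by simp [h1, h2]), Finset.sum_pair hne] at this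
  linarith

/-- The degenerate edge at weight `y = 0`: all strategies stay at the vertex, and the aspiration
error stays at most `r < δ`. -/
lemma startMean_nhd_self (hG : Admissible G) (hN : TameNoise G N p r) (i₀ : Fin n) (hr : r < δ)
    (t : ℕ) : startMean G N α α ((nhd p G δ α).indicator 1) t = 1 := by
  have hu := isUnitFun_indicator (measurableSet_nhd (p := p) (G := G) (δ := δ) (β := α))
  refine le_antisymm (startMean_le_one hu t) ?_
  have hη := mul_pos hG.ε_pos hG.h_pos
  obtain ⟨k, hk⟩ := exists_nat_gt (1 / (G.ε * G.h))
  rw [div_lt_iff₀ hη] at hk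
  calc (1 : ℝ) = ∫ _, (1 : ℝ) ∂N := by simp
    _ ≤ _ := by
      refine integral_mono_ae (integrable_const _) ((hu.expect t).integrable_next _ _) ?_
      filter_upwards [hN] with υ hυ
      obtain ⟨θ, -, -, hθ⟩ := (onEdge_pureState G α α).next (j := i₀) hG hυ.1 fun _ _ => rfl
      have hz : OnEdge α α 0 (next G (pureState G α) α υ) := fun i b => by
        rw [hθ i b]; ring
      have := pow_le_expect_nhd (j := i₀) (k := k) (δ := δ) (p := p) hG hN (fun _ _ => rfl)
        (by nlinarith) t
        _ 0 0 hz le_rfl zero_le_one (fun _ => rfl)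
        (by simpa using hN.radius_nonneg.trans_lt hr) ?_ (by simpa using hr)
      · simpa using this
      · have h9 := aspDist_next_le p hG α α (pureState G α) υ
        rw [aspDist_pureState, utilDist_self] at h9
        have := hυ.2
        have h10 := norm_nonneg (WithLp.toLp p υ : PiLp p fun _ : Fin n => ℝ)
        have h11 := (mul_pos hG.ε_pos hG.ν_pos)
        have h12 := hG.step_lt_one
        nlinarith

lemma tendsto_startMean_nhd_self_other (hG : Admissible G) (hN : TameNoise G N p r) (i₀ : Fin n)
    (hr : r < δ) {γ : Profile A} (h : γ ≠ α) (t : ℕ) :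
    startMean G N α α ((nhd p G δ γ).indicator 1) t = 0 := by
  have hu := isUnitFun_indicator (measurableSet_nhd (p := p) (G := G) (δ := δ) (β := γ))
  refine le_antisymm ?_ (startMean_nonneg hu t)
  have := sum_startMean_nhd_le_one (G := G) (N := N) (α := α) (β := α) (p := p) (δ := δ)
    {γ, α} t
  rw [Finset.sum_pair h, startMean_nhd_self hG hN i₀ hr] at this
  linarith

lemma ofReal_startMean_nhd (t : ℕ) (γ : Profile A) :
    ENNReal.ofReal (startMean G N α β ((nhd p G δ γ).indicator 1) t)
      = ∫⁻ υ, (unperturbed G N ^ t) (next G (pureState G α) β υ) (nhd p G δ γ) ∂N := by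
  have hu := isUnitFun_indicator (measurableSet_nhd (p := p) (G := G) (δ := δ) (β := γ))
  rw [startMean, ofReal_integral_eq_lintegral_ofReal ((hu.expect t).integrable_next _ _)
    (ae_of_all _ fun _ => (hu.expect t).nonneg _)]
  exact lintegral_congr fun υ => ofReal_expect_indicator _ measurableSet_nhd t _

/-- The one-step hitting probability is at least the absorption probability. -/
lemma absorbProb_le_hitProb (hG : Admissible G) (hN : TameNoise G N p r)
    (hij : ∀ i, i ≠ j → α i = β i) (hj : α j ≠ β j) (hk : 1 ≤ (k + 1) * (G.ε * G.h)) (hr : r < δ) :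
    absorbProb G N j k α β ≤ hitProb p G N δ α β := by
  have hu := isUnitFun_indicator (measurableSet_nhd (p := p) (G := G) (δ := δ) (β := β))
  refine le_of_tendsto' (tendsto_startMean_nhd hG hN hij hj hk hr).1 fun t => ?_
  rw [hitProb, ← ENNReal.ofReal_le_iff_le_toReal, ofReal_startMean_nhd]
  · refine lintegral_mono fun υ => ?_
    change _ ≤ chainLaw (unperturbed G N) _ _
    rw [chainLaw_hit _ measurableSet_nhd]
    exact (pow_le_hitWithin _ measurableSet_nhd t _).trans
      (le_iSup (fun T => hitWithin (unperturbed G N) (nhd p G δ β) T _) t)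
  · refine ne_top_of_le_ne_top ENNReal.one_ne_top ?_
    calc _ ≤ ∫⁻ _, 1 ∂N := lintegral_mono fun υ => by
          change chainLaw (unperturbed G N) _ _ ≤ 1
          exact prob_le_one
      _ = 1 := by simp

/-- The one-step hitting probability is hardly larger than the absorption probability. -/
lemma hitProb_mul_le_absorbProb (hG : Admissible G) (hN : TameNoise G N p r)
    (hij : ∀ i, i ≠ j → α i = β i) (hj : α j ≠ β j) (hk : 1 ≤ (k + 1) * (G.ε * G.h)) (hδ : δ ≤ 1) :
    (1 - δ) ^ (k + 2) * hitProb p G N δ α β ≤ absorbProb G N j k α β := by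
  have hδ' : 0 ≤ 1 - δ := by linarith
  have hfu := isUnitFun_coordPow (A := A) j (β j) (k + 2)
  have hS := isAbsorbing_edgeSet hG hN hij hj (le_refl (utilDist p G α β + r))
  -- In the neighborhood the probability of `β j` exceeds `1 - δ`; the maximal inequality for its
  -- power then applies.
  have hB : ∀ z ∈ edgeSet G p α β (utilDist p G α β + r), z ∈ nhd p G δ β →
      (1 - δ) ^ (k + 2) ≤ coordPow j (β j) (k + 2) z := by
    intro z _ hz
    have h1 := abs_coord_sub_le_strategyDist (p := p) (β := β) z j (β j)
    have h2 := (mem_nhd_iff.1 hz).2.1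
    rw [Pi.single_eq_same] at h1
    have h3 := (abs_le.1 h1).1
    exact pow_le_pow_left₀ hδ' (by linarith) _
  have hT : ∀ T, ENNReal.ofReal ((1 - δ) ^ (k + 2)) *
      ∫⁻ υ, hitWithin (unperturbed G N) (nhd p G δ β) T (next G (pureState G α) β υ) ∂N
      ≤ ENNReal.ofReal (absorbProb G N j k α β) := by
    intro T
    refine le_trans ?_ (ENNReal.ofReal_le_ofReal (startMean_le_absorbProb T))
    rw [startMean, ofReal_integral_eq_lintegral_ofReal ((hfu.expect T).integrable_next _ _)
      (ae_of_all _ fun _ => (hfu.expect T).nonneg _), ← lintegral_const_mul' _ _ ENNReal.ofReal_ne_top]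
    refine lintegral_mono_ae ?_
    filter_upwards [ae_next_mem_edgeSet hG hN hij] with υ hυ
    exact mul_hitWithin_le hfu hS (fun z hz => coordPow_le_expect hG hN hij hj hk hz) hB T _ hυ
  have hI : ∫⁻ υ, pathLaw G N (next G (pureState G α) β υ) {ω | ∃ t, ω t ∈ nhd p G δ β} ∂N
      = ⨆ T, ∫⁻ υ, hitWithin (unperturbed G N) (nhd p G δ β) T
          (next G (pureState G α) β υ) ∂N := by
    rw [← lintegral_iSup]
    · refine lintegral_congr fun υ => ?_
      exact chainLaw_hit _ measurableSet_nhd _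
    · exact fun T => (measurable_hitWithin _ measurableSet_nhd T).comp
        (measurable_next_noise G _ β)
    · exact fun s t hst υ => hitWithin_mono _ _ hst _
  have hmain : ENNReal.ofReal ((1 - δ) ^ (k + 2)) *
      ∫⁻ υ, pathLaw G N (next G (pureState G α) β υ) {ω | ∃ t, ω t ∈ nhd p G δ β} ∂N
      ≤ ENNReal.ofReal (absorbProb G N j k α β) := by
    rw [hI, ENNReal.mul_iSup]
    exact iSup_le hT
  have := ENNReal.toReal_mono ENNReal.ofReal_ne_top hmain
  rwa [ENNReal.toReal_mul, ENNReal.toReal_ofReal (pow_nonneg hδ' _),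
    ENNReal.toReal_ofReal absorbProb_nonneg] at this

end Limits

/-! ### The tremble-and-absorb matrix and its stationary distribution. -/

section LimitMatrix

variable {n : ℕ} {A : Fin n → Type*} [∀ i, Fintype (A i)] [∀ i, DecidableEq (A i)]

/-- The probability that `β` is played after a single trembling out of the pure strategy state
of `α`. -/
def trembleWeight (α β : Profile A) : ℝ :=
  ∑ j, (1 / (n : ℝ)) * ∏ i, if i = j then 1 / (Fintype.card (A i) : ℝ)
    else (Pi.single (α i) 1 : A i → ℝ) (β i)

lemma trembleWeight_term_nonneg (α β : Profile A) (j : Fin n) :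
    0 ≤ (1 / (n : ℝ)) * ∏ i, if i = j then 1 / (Fintype.card (A i) : ℝ)
      else (Pi.single (α i) 1 : A i → ℝ) (β i) := by
  refine mul_nonneg (by positivity) (Finset.prod_nonneg fun i _ => ?_)
  split_ifs
  · positivity
  · exact (single_mem_stdSimplex ℝ (α i)).1 (β i)

lemma trembleWeight_nonneg (α β : Profile A) : 0 ≤ trembleWeight α β :=
  Finset.sum_nonneg fun j _ => trembleWeight_term_nonneg α β j

lemma sum_trembleWeight (hn : 0 < n) [∀ i, Nonempty (A i)] (α : Profile A) :
    ∑ β, trembleWeight α β = 1 := by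
  unfold trembleWeight
  rw [Finset.sum_comm]
  have h : ∀ j : Fin n, ∑ β : Profile A, (1 / (n : ℝ)) * ∏ i, (if i = j then
      1 / (Fintype.card (A i) : ℝ) else (Pi.single (α i) 1 : A i → ℝ) (β i)) = 1 / n := by
    intro j
    have := (Finset.prod_univ_sum (fun i : Fin n => (Finset.univ : Finset (A i)))
      fun i a => if i = j then 1 / (Fintype.card (A i) : ℝ)
        else (Pi.single (α i) 1 : A i → ℝ) a).symm
    rw [Fintype.piFinset_univ] at this
    rw [← Finset.mul_sum, this, Finset.prod_eq_one, mul_one]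
    intro i _
    split_ifs
    · simp
    · exact (single_mem_stdSimplex ℝ (α i)).2
  rw [Finset.sum_congr rfl fun j _ => h j]
  have : (n : ℝ) ≠ 0 := by positivity
  simp [this]

lemma trembleWeight_le_one (hn : 0 < n) [∀ i, Nonempty (A i)] (α β : Profile A) :
    trembleWeight α β ≤ 1 := by
  rw [← sum_trembleWeight hn α]
  exact Finset.single_le_sum (fun β _ => trembleWeight_nonneg α β) (Finset.mem_univ β)

lemma OneStep.exists_player {α β : Profile A} (h : OneStep α β) :
    ∃ j, α j ≠ β j ∧ ∀ i, i ≠ j → α i = β i := by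
  obtain ⟨j, hj, hu⟩ := h
  exact ⟨j, hj, fun i hi => by_contra fun hne => hi (hu i hne)⟩

lemma trembleWeight_pos (hn : 0 < n) [∀ i, Nonempty (A i)] {α β : Profile A} (h : OneStep α β) :
    0 < trembleWeight α β := by
  obtain ⟨j, -, hij⟩ := h.exists_player
  refine lt_of_lt_of_le ?_ (Finset.single_le_sum
    (fun j _ => trembleWeight_term_nonneg α β j) (Finset.mem_univ j))
  refine mul_pos (by positivity) (Finset.prod_pos fun i _ => ?_)
  split_ifs with hi
  · have := Fintype.card_pos (α := A i)
    positivity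
  · rw [hij i hi]
    simp

/-- Whoever trembles, some other player would have to leave its pure action, which has probability
zero. -/
lemma trembleWeight_eq_zero {α β : Profile A} (hne : α ≠ β) (h : ¬ OneStep α β) :
    trembleWeight α β = 0 := by
  refine Finset.sum_eq_zero fun j _ => ?_
  obtain ⟨i, hi, hi'⟩ : ∃ i, i ≠ j ∧ α i ≠ β i := by
    by_contra! hc
    refine h ⟨j, fun e => hne (funext fun i => ?_), fun i hi => by_contra fun hij => hi (hc i hij)⟩
    by_cases hi : i = j
    · rw [hi, e]
    · exact hc i hi
  rw [Finset.prod_eq_zero (Finset.mem_univ i), mul_zero]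
  simp [hi, Ne.symm hi']

/-- The probability that the chain settles in `γ` after a trembling from `α` in which `β` is played,
where `q` is the matrix of absorption probabilities. -/
def settleProb (q : Profile A → Profile A → ℝ) (α β γ : Profile A) : ℝ :=
  if β = α then (if γ = α then 1 else 0)
  else if γ = β then q α β else if γ = α then 1 - q α β else 0

/-- The transition matrix of the trembles followed by absorption. -/
def absorbMatrix (q : Profile A → Profile A → ℝ) : Matrix (Profile A) (Profile A) ℝ :=
  fun α γ => ∑ β, trembleWeight α β * settleProb q α β γ

/-- After a tremble to `β` the chain settles in `α` or `β`, so a move from `α` to `γ` requires that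
`γ` itself was played. -/
lemma absorbMatrix_of_ne (q : Profile A → Profile A → ℝ) {α γ : Profile A} (h : α ≠ γ) :
    absorbMatrix q α γ = trembleWeight α γ * q α γ := by
  unfold absorbMatrix
  rw [Finset.sum_eq_single γ]
  · simp [settleProb, h.symm]
  · intro β _ hβ
    simp [settleProb, h.symm, hβ.symm]
  · simp

lemma settleProb_nonneg {q : Profile A → Profile A → ℝ} (h0 : ∀ α β, 0 ≤ q α β)
    (h1 : ∀ α β, q α β ≤ 1) (α β γ : Profile A) : 0 ≤ settleProb q α β γ := by
  unfold settleProb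
  split_ifs
  · exact zero_le_one
  · exact le_rfl
  · exact h0 _ _
  · exact sub_nonneg.2 (h1 _ _)
  · exact le_rfl

lemma sum_settleProb (q : Profile A → Profile A → ℝ) (α β : Profile A) :
    ∑ γ, settleProb q α β γ = 1 := by
  by_cases h : β = α
  · simp [settleProb, h]
  · rw [Finset.sum_eq_add_of_mem β α (Finset.mem_univ _) (Finset.mem_univ _) h]
    · simp [settleProb, h, Ne.symm h]
    · rintro γ - ⟨h1, h2⟩
      simp [settleProb, h, h1, h2]

lemma absorbMatrix_nonneg {q : Profile A → Profile A → ℝ} (h0 : ∀ α β, 0 ≤ q α β)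
    (h1 : ∀ α β, q α β ≤ 1) (α γ : Profile A) : 0 ≤ absorbMatrix q α γ :=
  Finset.sum_nonneg fun β _ => mul_nonneg (trembleWeight_nonneg α β) (settleProb_nonneg h0 h1 α β γ)

lemma sum_absorbMatrix (hn : 0 < n) [∀ i, Nonempty (A i)] (q : Profile A → Profile A → ℝ)
    (α : Profile A) : ∑ γ, absorbMatrix q α γ = 1 := by
  unfold absorbMatrix
  rw [Finset.sum_comm, ← sum_trembleWeight hn α]
  exact Finset.sum_congr rfl fun β _ => by rw [← Finset.mul_sum, sum_settleProb, mul_one]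

open Classical in
/-- Any two profiles are joined by one-step transitions: there is a spanning tree of such transitions
rooted at every profile. -/
lemma exists_rootedMap_oneStep (hn : 0 < n) (s : Profile A) :
    ∃ f ∈ rootedMaps s, ∀ v, v ≠ s → OneStep v (f v) := by
  have hex : ∀ v : Profile A, v ≠ s → ∃ i, v i ≠ s i := fun v hv => Function.ne_iff.1 hv
  have : Nonempty (Fin n) := ⟨⟨0, hn⟩⟩
  choose! d hd using hex
  -- The tree corrects one coordinate that disagrees with `s` at a time, so the Hamming distance to
  -- `s` drops by one with each arrow.
  set f : Profile A → Profile A := fun v => if v = s then s else Function.update v (d v) (s (d v))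
    with hf
  have hfs : f s = s := by simp [hf]
  have hfv : ∀ v, v ≠ s → f v = Function.update v (d v) (s (d v)) := fun v hv => by simp [hf, hv]
  have hreach : ∀ m : ℕ, ∀ v : Profile A, (Finset.univ.filter fun i => v i ≠ s i).card = m →
      ∃ k, f^[k] v = s := by
    intro m
    induction m with
    | zero =>
      intro v hv
      refine ⟨0, funext fun i => ?_⟩
      rw [Finset.card_eq_zero, Finset.filter_eq_empty_iff] at hv
      exact not_not.1 (hv (Finset.mem_univ i))
    | succ m ih =>
      intro v hv
      have hvs : v ≠ s := by
        rintro rfl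
        simp at hv
      obtain ⟨k, hk⟩ := ih (f v) (by
        have : (Finset.univ.filter fun i => f v i ≠ s i)
            = (Finset.univ.filter fun i => v i ≠ s i).erase (d v) := by
          ext i
          simp only [hfv v hvs, Finset.mem_filter, Finset.mem_univ, true_and, Finset.mem_erase]
          by_cases hi : i = d v
          · subst hi; simp
          · simp [hi]
        rw [this, Finset.card_erase_of_mem (by simpa using hd v hvs), hv]
        rfl)
      exact ⟨k + 1, by rwa [Function.iterate_succ_apply]⟩
  refine ⟨f, by simpa [rootedMaps, hfs] using fun v => hreach _ v rfl, fun v hv => ?_⟩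
  rw [hfv v hv]
  refine ⟨d v, by simpa using hd v hv, fun i hi => ?_⟩
  by_contra hne
  simp [Function.update_of_ne hne] at hi

open Classical in
-- A tree with an arrow that is not a one-step transition has weight zero because its tremble weight
-- vanishes. On the others every entry is off-diagonal and factorizes.
lemma treeWeight_absorbMatrix (q : Profile A → Profile A → ℝ) (s : Profile A) :
    treeWeight (absorbMatrix q) s
      = ∑ g ∈ oneStepGraphs s, (∏ e ∈ g, trembleWeight e.1 e.2) * ∏ e ∈ g, q e.1 e.2 := by
  refine (sum_isWGraph_eq_treeWeight (absorbMatrix q) s).symm.trans ?_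
  have hsub : oneStepGraphs s ⊆ Finset.univ.filter
      (fun g : Finset (Profile A × Profile A) => IsWGraph {s} g) := by
    intro g hg
    simp only [oneStepGraphs, Finset.mem_filter] at hg ⊢
    exact ⟨hg.1, hg.2.1⟩
  rw [← Finset.sum_subset hsub]
  · refine Finset.sum_congr rfl fun g hg => ?_
    rw [← Finset.prod_mul_distrib]
    refine Finset.prod_congr rfl fun e he => absorbMatrix_of_ne q ?_
    simp only [oneStepGraphs, Finset.mem_filter] at hg
    exact (hg.2.1.ne e he).symm
  · intro g hg hg'
    simp only [oneStepGraphs, Finset.mem_filter, Finset.mem_univ, true_and, not_and,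
      not_forall] at hg hg'
    obtain ⟨e, he, hne⟩ := hg' hg
    refine Finset.prod_eq_zero he ?_
    have hee := (hg.ne e he).symm
    rw [absorbMatrix_of_ne q hee, trembleWeight_eq_zero hee hne, zero_mul]

lemma treeWeight_nonneg {V : Type*} [Fintype V] [DecidableEq V] {M : V → V → ℝ}
    (h0 : ∀ a b, 0 ≤ M a b) (s : V) : 0 ≤ treeWeight M s :=
  Finset.sum_nonneg fun _ _ => Finset.prod_nonneg fun _ _ => h0 _ _

lemma treeWeight_pos (hn : 0 < n) [∀ i, Nonempty (A i)] {q : Profile A → Profile A → ℝ}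
    (h0 : ∀ α β, 0 ≤ q α β) (h1 : ∀ α β, q α β ≤ 1) (hq : ∀ α β, OneStep α β → 0 < q α β)
    (s : Profile A) : 0 < treeWeight (absorbMatrix q) s := by
  obtain ⟨f, hf, hfo⟩ := exists_rootedMap_oneStep hn s
  refine Finset.sum_pos' (fun _ _ => Finset.prod_nonneg fun _ _ => absorbMatrix_nonneg h0 h1 _ _)
    ⟨f, hf, Finset.prod_pos fun v hv => ?_⟩
  have h := hfo v (Finset.ne_of_mem_erase hv)
  have hne : v ≠ f v := by
    obtain ⟨j, hj, -⟩ := h.exists_player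
    exact fun e => hj (congrFun e j)
  rw [absorbMatrix_of_ne q hne]
  exact mul_pos (trembleWeight_pos hn h) (hq _ _ h)

/-- The stationary distribution of the tremble-and-absorb chain is unique and given by trees. -/
lemma isStationary_absorbMatrix_iff (hn : 0 < n) [∀ i, Nonempty (A i)]
    {q : Profile A → Profile A → ℝ}
    (h0 : ∀ α β, 0 ≤ q α β) (h1 : ∀ α β, q α β ≤ 1) (hq : ∀ α β, OneStep α β → 0 < q α β)
    (π : Profile A → ℝ) : IsStationary (absorbMatrix q) π ↔
      π = fun s => treeWeight (absorbMatrix q) s / ∑ s', treeWeight (absorbMatrix q) s' := by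
  set T := ∑ s', treeWeight (absorbMatrix q) s' with hT
  have hTpos : 0 < T := Finset.sum_pos (fun s _ => treeWeight_pos hn h0 h1 hq s)
    ⟨Classical.arbitrary _, Finset.mem_univ _⟩
  have hst : IsStationary (absorbMatrix q) fun s => treeWeight (absorbMatrix q) s / T := by
    refine ⟨⟨fun s => div_nonneg (treeWeight_nonneg (absorbMatrix_nonneg h0 h1) s) hTpos.le, ?_⟩, ?_⟩
    · rw [← Finset.sum_div, ← hT, div_self hTpos.ne']
    · have h := vecMul_treeWeight (absorbMatrix q) (sum_absorbMatrix hn q)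
      have e : (fun s => treeWeight (absorbMatrix q) s / T)
          = T⁻¹ • treeWeight (absorbMatrix q) := by
        funext s
        simp [div_eq_inv_mul]
      rw [e, Matrix.smul_vecMul, h]
  constructor
  · intro hπ
    refine IsStationary.unique (absorbMatrix_nonneg h0 h1) (sum_absorbMatrix hn q) (fun s => ?_)
      hπ hst
    obtain ⟨f, hf, hfo⟩ := exists_rootedMap_oneStep hn s
    refine ⟨f, hf, fun v hv => ?_⟩
    have h := hfo v hv
    have hne : v ≠ f v := by
      obtain ⟨j, hj, -⟩ := h.exists_player
      exact fun e => hj (congrFun e j)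
    rw [absorbMatrix_of_ne q hne]
    exact mul_pos (trembleWeight_pos hn h) (hq _ _ h)
  · rintro rfl
    exact hst

end LimitMatrix

/-! ### Identification of the limit chain for small fixed noise. -/

section LimitChain

variable {n : ℕ} {A : Fin n → Type*} [∀ i, Fintype (A i)] [∀ i, DecidableEq (A i)]
  [∀ i, MeasurableSpace (A i)] [∀ i, MeasurableSingletonClass (A i)]
  {G : Params A} {N : Measure (Fin n → ℝ)} [IsProbabilityMeasure N]
  {p : ℝ≥0∞} [Fact (1 ≤ p)] {r δ : ℝ} {k : ℕ}

open Classical in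
variable (G N) in
/-- The matrix of absorption probabilities of the one-step transitions. -/
def edgeProb (k : ℕ) (α β : Profile A) : ℝ :=
  if h : OneStep α β then absorbProb G N h.exists_player.choose k α β else 0

/-- The deviating player is fixed before the noise law, so that noisy and noiseless absorption
probabilities refer to the same coordinate. -/
lemma OneStep.edgeProb_eq {α β : Profile A} (h : OneStep α β) :
    ∃ j, α j ≠ β j ∧ (∀ i, i ≠ j → α i = β i) ∧
      ∀ (N : Measure (Fin n → ℝ)) [IsProbabilityMeasure N],
        edgeProb G N k α β = absorbProb G N j k α β :=
  ⟨h.exists_player.choose, h.exists_player.choose_spec.1, h.exists_player.choose_spec.2,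
    fun N _ => by simp [edgeProb, h]⟩

lemma edgeProb_nonneg (α β : Profile A) : 0 ≤ edgeProb G N k α β := by
  by_cases h : OneStep α β
  · obtain ⟨j, -, -, e⟩ := h.edgeProb_eq (G := G) (k := k)
    rw [e]
    exact absorbProb_nonneg
  · simp [edgeProb, h]

lemma edgeProb_le_one (α β : Profile A) : edgeProb G N k α β ≤ 1 := by
  by_cases h : OneStep α β
  · obtain ⟨j, -, -, e⟩ := h.edgeProb_eq (G := G) (k := k)
    rw [e]
    exact absorbProb_le_one
  · simp [edgeProb, h]

/-- The trembled play of `β` alone gives `β j` probability at least `ε h`, and the means of the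
submartingale are bounded by their supremum, so time 0 suffices. -/
lemma edgeProb_pos (hG : Admissible G) (hN : TameNoise G N p r) {α β : Profile A}
    (h : OneStep α β) : 0 < edgeProb G N k α β := by
  obtain ⟨j, hj, hij, e⟩ := h.edgeProb_eq (G := G) (k := k)
  rw [e]
  have hη := mul_pos hG.ε_pos hG.h_pos
  refine lt_of_lt_of_le (pow_pos hη (k + 2)) (le_trans ?_ (startMean_le_absorbProb 0))
  calc (G.ε * G.h) ^ (k + 2) = ∫ _, (G.ε * G.h) ^ (k + 2) ∂N := by simp
    _ ≤ _ := by
      refine integral_mono_ae (integrable_const _)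
        (((isUnitFun_coordPow _ _ _).expect 0).integrable_next _ _) ?_
      filter_upwards [hN] with υ hυ
      obtain ⟨θ, hθ, -, hz⟩ := (onEdge_pureState G α β).next hG hυ.1 hij
      simp only [expect, coordPow]
      rw [hz.eq_apply' hj]
      exact pow_le_pow_left₀ hη.le (by linarith) _

lemma comp_oneTremble_toReal (α γ : Profile A) (t : ℕ) :
    (((unperturbed G N ^ t) ∘ₖ oneTremble G N) (pureState G α) (nhd p G δ γ)).toReal
      = ∑ β, trembleWeight α β * startMean G N α β ((nhd p G δ γ).indicator 1) t := by
  have hu := isUnitFun_indicator (measurableSet_nhd (p := p) (G := G) (δ := δ) (β := γ))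
  have hpos : ∀ β, 0 ≤ trembleWeight α β * startMean G N α β ((nhd p G δ γ).indicator 1) t :=
    fun β => mul_nonneg (trembleWeight_nonneg α β) (startMean_nonneg hu t)
  have h : ((unperturbed G N ^ t) ∘ₖ oneTremble G N) (pureState G α) (nhd p G δ γ)
      = ENNReal.ofReal
        (∑ β, trembleWeight α β * startMean G N α β ((nhd p G δ γ).indicator 1) t) := by
    rw [Kernel.comp_apply' _ _ _ measurableSet_nhd, oneTremble, stepKernel_apply,
      lintegral_finsetSum_measure, ENNReal.ofReal_sum_of_nonneg fun β _ => hpos β]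
    refine Finset.sum_congr rfl fun β _ => ?_
    rw [lintegral_smul_measure, lintegral_map (Kernel.measurable_coe _ measurableSet_nhd)
      (measurable_next_noise G _ β), ENNReal.ofReal_mul (trembleWeight_nonneg α β),
      ofReal_startMean_nhd]
    rfl
  rw [h, ENNReal.toReal_ofReal (Finset.sum_nonneg fun β _ => hpos β)]

lemma tendsto_comp_oneTremble (hn : 0 < n) (hG : Admissible G) (hN : TameNoise G N p r)
    (hr : r < δ) (hk : 1 ≤ (k + 1) * (G.ε * G.h)) (α γ : Profile A) :
    Tendsto (fun t : ℕ =>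
        (((unperturbed G N ^ t) ∘ₖ oneTremble G N) (pureState G α) (nhd p G δ γ)).toReal)
      atTop (𝓝 (absorbMatrix (edgeProb G N k) α γ)) := by
  simp only [comp_oneTremble_toReal]
  refine tendsto_finsetSum _ fun β _ => ?_
  by_cases hβ : β = α
  · subst hβ
    refine Tendsto.const_mul _ ?_
    by_cases hγ : γ = β
    · subst hγ
      simp only [settleProb, if_true]
      exact tendsto_const_nhds.congr fun t => (startMean_nhd_self hG hN ⟨0, hn⟩ hr t).symm
    · simp only [settleProb, if_true, if_neg hγ]
      exact tendsto_const_nhds.congr fun t =>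
        (tendsto_startMean_nhd_self_other hG hN ⟨0, hn⟩ hr hγ t).symm
  by_cases h : OneStep α β
  · refine Tendsto.const_mul _ ?_
    obtain ⟨j, hj, hij, e⟩ := h.edgeProb_eq (G := G) (k := k)
    simp only [settleProb, if_neg hβ, e]
    obtain ⟨l1, l2⟩ := tendsto_startMean_nhd hG hN hij hj hk hr
    split_ifs with h1 h2
    · rw [h1]; exact l1
    · rw [h2]; exact l2
    · exact tendsto_startMean_nhd_other hG hN hij hj hk hr h2 h1
  -- Several deviating players: no convergence is known here, but the weight is zero.
  · simp [trembleWeight_eq_zero (Ne.symm hβ) h]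

lemma limitChain_eq (hn : 0 < n) (hG : Admissible G) (hN : TameNoise G N p r)
    (hr : r < δ) (hk : 1 ≤ (k + 1) * (G.ε * G.h)) :
    limitChain p G N δ = absorbMatrix (edgeProb G N k) := by
  funext α γ
  exact (tendsto_comp_oneTremble hn hG hN hr hk α γ).limUnder_eq

end LimitChain

/-! ### Continuity of the absorption probabilities at zero noise. -/

section VanishingNoise

/-- The two branches meet at `y = 0` because `max h x = x`; this is where `h ≤ x` is needed. -/
lemma continuousAt_aspirationFactor {h c x y : ℝ} (hx : h ≤ x) :
    ContinuousAt (fun q : ℝ × ℝ => aspirationFactor h c q.1 q.2) (x, y) := by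
  have h1 : ContinuousAt (fun q : ℝ × ℝ => q.1) (x, y) := continuousAt_fst
  have h2 : ContinuousAt (fun q : ℝ × ℝ => max h (q.1 + c * q.2)) (x, y) := by fun_prop
  rcases lt_trichotomy y 0 with hy | rfl | hy
  · refine h2.congr ?_
    filter_upwards [continuousAt_snd.eventually_lt_const hy] with q hq
    simp [aspirationFactor, not_le.2 hq]
  · have e : max h (x + c * 0) = x := by simp [hx]
    unfold ContinuousAt at h1 h2 ⊢
    simp only [e] at h2
    simp only [aspirationFactor, le_refl, if_true]
    exact h1.if' h2
  · refine h1.congr ?_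
    filter_upwards [continuousAt_snd.eventually_const_lt hy] with q hq
    simp [aspirationFactor, le_of_lt hq]

variable {n : ℕ} {A : Fin n → Type*} [∀ i, Fintype (A i)] [∀ i, DecidableEq (A i)]

/-- The states whose strategies and aspiration levels are close to those of `z`. -/
def near (z : State A) : Filter (State A) :=
  comap (fun z : State A => (z.2.1, z.2.2.1)) (𝓝 (z.2.1, z.2.2.1))

lemma tendsto_const_near {ι : Type*} (l : Filter ι) (z : State A) :
    Tendsto (fun _ => z) l (near z) := tendsto_comap_iff.2 tendsto_const_nhds

lemma tendsto_coord_near (z : State A) (i : Fin n) (b : A i) :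
    Tendsto (fun z : State A => (z.2.1 i).1 b) (near z) (𝓝 ((z.2.1 i).1 b)) := by
  have hc : Continuous fun q : (∀ i, stdSimplex ℝ (A i)) × (Fin n → ℝ) => (q.1 i).1 b :=
    (continuous_apply b).comp (continuous_subtype_val.comp (by fun_prop))
  exact (hc.tendsto (z.2.1, z.2.2.1)).comp tendsto_comap

lemma tendsto_asp_near (z : State A) (i : Fin n) :
    Tendsto (fun z : State A => z.2.2.1 i) (near z) (𝓝 (z.2.2.1 i)) := by
  have hc : Continuous fun q : (∀ i, stdSimplex ℝ (A i)) × (Fin n → ℝ) => q.2 i := by fun_prop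
  exact (hc.tendsto (z.2.1, z.2.2.1)).comp tendsto_comap

lemma tendsto_next_near {G : Params A} (hG : TameAt G 0) (z : State A) (γ : Profile A) :
    Tendsto (fun q : State A × (Fin n → ℝ) => next G q.1 γ q.2) (near z ×ˢ 𝓝 0)
      (near (next G z γ 0)) := by
  have hU : ∀ i, Tendsto (fun q : State A × (Fin n → ℝ) => measuredUtility G γ q.2 i)
      (near z ×ˢ 𝓝 0) (𝓝 (measuredUtility G γ 0 i)) := fun i =>
    (((continuous_apply i).tendsto (0 : Fin n → ℝ)).comp tendsto_snd).const_add _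
  have hρ : ∀ i, Tendsto (fun q : State A × (Fin n → ℝ) => q.1.2.2.1 i)
      (near z ×ˢ 𝓝 0) (𝓝 (z.2.2.1 i)) := fun i => (tendsto_asp_near z i).comp tendsto_fst
  refine tendsto_comap_iff.2 (Tendsto.prodMk_nhds ?_ ?_)
  · refine tendsto_pi_nhds.2 fun i => tendsto_subtype_rng.2 (tendsto_pi_nhds.2 fun b => ?_)
    have hx : Tendsto (fun q : State A × (Fin n → ℝ) => (q.1.2.1 i).1 b)
      (near z ×ˢ 𝓝 0) (𝓝 ((z.2.1 i).1 b)) := (tendsto_coord_near z i b).comp tendsto_fst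
    have hφ := (continuousAt_aspirationFactor (c := G.c)
      (y := measuredUtility G γ 0 i - z.2.2.1 i) (hG i γ).1).tendsto.comp
        ((hU i).prodMk_nhds ((hU i).sub (hρ i)))
    exact hx.add ((tendsto_const_nhds.max ((hφ.const_mul G.ε).min tendsto_const_nhds)).mul
      (tendsto_const_nhds.sub hx))
  · exact tendsto_pi_nhds.2 fun i => (hρ i).add (((hU i).sub (hρ i)).const_mul _)

variable [∀ i, MeasurableSpace (A i)] [∀ i, MeasurableSingletonClass (A i)]
  {G : Params A} {p : ℝ≥0∞} [Fact (1 ≤ p)] {ι : Type*} {l : Filter ι}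
  {N : ι → Measure (Fin n → ℝ)} [∀ i, IsProbabilityMeasure (N i)] {r : ι → ℝ}

/-- The noise is almost surely confined to balls that shrink to 0. -/
lemma eventually_ae_of_eventually_nhds (hN : ∀ᶠ i in l, TameNoise G (N i) p (r i))
    (hr : Tendsto r l (𝓝 0)) {P : (Fin n → ℝ) → Prop} (hP : ∀ᶠ υ in 𝓝 0, P υ) :
    ∀ᶠ i in l, ∀ᵐ υ ∂(N i), P υ := by
  have hc : Tendsto (WithLp.ofLp : (PiLp p fun _ : Fin n => ℝ) → Fin n → ℝ) (𝓝 0) (𝓝 0) :=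
    (PiLp.continuous_ofLp p fun _ : Fin n => ℝ).tendsto 0
  obtain ⟨ρ, hρ, hρP⟩ := Metric.eventually_nhds_iff.1 (hc.eventually hP)
  filter_upwards [hN, hr.eventually_lt_const hρ] with i hi hri
  filter_upwards [hi] with υ hυ
  exact hρP (y := WithLp.toLp p υ) (by rw [dist_zero_right]; exact hυ.2.trans_lt hri)

/-- The integrand varies with the noise law, and convergence is joint in the law and the state; this
form can be iterated over the time horizon. -/
lemma tendsto_integral_next (hG : TameAt G 0) (hN : ∀ᶠ i in l, TameNoise G (N i) p (r i))
    (hr : Tendsto r l (𝓝 0)) {F : ι → State A → ℝ} (hF : ∀ i, IsUnitFun (F i)) {z : State A}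
    {γ : Profile A} {c : ℝ} (h : Tendsto (fun q : ι × State A => F q.1 q.2)
      (l ×ˢ near (next G z γ 0)) (𝓝 c)) :
    Tendsto (fun q : ι × State A => ∫ υ, F q.1 (next G q.2 γ υ) ∂(N q.1)) (l ×ˢ near z) (𝓝 c) := by
  rw [Metric.tendsto_nhds]
  intro e he
  obtain ⟨Pl, hPl, Ps, hPs, hP⟩ := eventually_prod_iff.1
    (Metric.tendsto_nhds.1 h (e / 2) (half_pos he))
  obtain ⟨Qs, hQs, Qu, hQu, hQ⟩ := eventually_prod_iff.1 ((tendsto_next_near hG z γ).eventually hPs)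
  have hQu' := eventually_ae_of_eventually_nhds hN hr hQu
  filter_upwards [(hPl.and hQu').prod_mk hQs] with q hq
  obtain ⟨⟨h1, h2⟩, h3⟩ := hq
  have hint := (hF q.1).integrable_next (N := N q.1) (G := G) q.2 γ
  have e1 : ∫ υ, F q.1 (next G q.2 γ υ) ∂(N q.1) - c
      = ∫ υ, (F q.1 (next G q.2 γ υ) - c) ∂(N q.1) := by
    rw [integral_sub hint (integrable_const c)]
    simp
  rw [Real.dist_eq, e1, ← Real.norm_eq_abs]
  refine lt_of_le_of_lt (norm_integral_le_of_norm_le_const (C := e / 2) ?_) ?_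
  · filter_upwards [h2] with υ hυ
    exact (hP h1 (hQ h3 hυ)).le
  · simpa using he

/-- As the noise vanishes, finite horizon expectations converge to those of the noiseless chain. -/
lemma tendsto_expect (hG : TameAt G 0) (hN : ∀ᶠ i in l, TameNoise G (N i) p (r i))
    (hr : Tendsto r l (𝓝 0)) {f : State A → ℝ} (hf : IsUnitFun f)
    (hfc : ∀ z, Tendsto f (near z) (𝓝 (f z))) (t : ℕ) :
    ∀ z : State A, Tendsto (fun q : ι × State A => expect (unperturbed G (N q.1)) f t q.2)
      (l ×ˢ near z) (𝓝 (expect (unperturbed G (Measure.dirac 0)) f t z)) := by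
  induction t with
  | zero => exact fun z => (hfc z).comp tendsto_snd
  | succ t ih =>
    intro z
    have e : ∀ (M : Measure (Fin n → ℝ)) [IsProbabilityMeasure M] (w : State A),
        expect (unperturbed G M) f (t + 1) w
          = ∑ γ, playProb w γ * ∫ υ, expect (unperturbed G M) f t (next G w γ υ) ∂M :=
      fun M _ w => integral_unperturbed G M (hf.expect t) w
    simp only [e]
    refine tendsto_finsetSum _ fun γ _ => Tendsto.mul ?_ ?_
    · exact (tendsto_finsetProd _ fun i _ => tendsto_coord_near z i (γ i)).comp tendsto_snd
    · rw [integral_dirac]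
      exact tendsto_integral_next hG hN hr
        (F := fun i => expect (unperturbed G (N i)) f t) (fun i => hf.expect t) (ih _)

lemma tendsto_startMean_noise (hG : TameAt G 0) (hN : ∀ᶠ i in l, TameNoise G (N i) p (r i))
    (hr : Tendsto r l (𝓝 0)) (α β : Profile A) (j : Fin n) (b : A j) (m t : ℕ) :
    Tendsto (fun i => startMean G (N i) α β (coordPow j b m) t) l
      (𝓝 (startMean G (Measure.dirac 0) α β (coordPow j b m) t)) := by
  have hf := isUnitFun_coordPow (A := A) j b m
  have h := tendsto_integral_next hG hN hr (z := pureState G α) (γ := β)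
    (fun i => hf.expect (κ := unperturbed G (N i)) t)
    (tendsto_expect hG hN hr hf (fun z => (tendsto_coord_near z j b).pow m) t _)
  have h' := h.comp (tendsto_id.prodMk (tendsto_const_near l (pureState G α)))
  rw [startMean, integral_dirac]
  exact h'

lemma tameNoise_dirac (hG : TameAt G 0) : TameNoise G (Measure.dirac 0) p 0 := by
  rw [TameNoise, ae_dirac_eq, eventually_pure]
  exact ⟨hG, by simp⟩

/-- As the noise vanishes, the absorption probabilities converge to those of the noiseless chain. -/
lemma tendsto_edgeProb (hA : Admissible G) (hG : TameAt G 0)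
    (hN : ∀ᶠ i in l, TameNoise G (N i) p (r i)) (hr : Tendsto r l (𝓝 0)) {k : ℕ}
    (hk : 1 ≤ (k + 1) * (G.ε * G.h)) (α β : Profile A) :
    Tendsto (fun i => edgeProb G (N i) k α β) l (𝓝 (edgeProb G (Measure.dirac 0) k α β)) := by
  by_cases h : OneStep α β
  swap
  · simpa [edgeProb, h] using tendsto_const_nhds
  obtain ⟨j, hj, hij, e⟩ := h.edgeProb_eq (G := G) (k := k)
  simp only [e]
  have hD : TameNoise G (Measure.dirac 0) p 0 := tameNoise_dirac hG
  rw [Metric.tendsto_nhds]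
  intro d hd
  -- The horizon is chosen from the common rate alone, hence before the noise. It bounds the tail by
  -- `d / 2` for the noisy and the noiseless chain alike.
  obtain ⟨t, ht⟩ := ((tendsto_rate_pow hA hD α j k).eventually_lt_const (half_pos hd)).exists
  filter_upwards [hN, Metric.tendsto_nhds.1
    (tendsto_startMean_noise hG hN hr α β j (β j) (k + 2) t) (d / 2) (half_pos hd)] with i hi hi'
  have h1 := absorbProb_le_startMean_add hA hi hij hj hk t
  have h2 := startMean_le_absorbProb (G := G) (N := N i) (α := α) (β := β) (j := j) (k := k) t
  have h3 := absorbProb_le_startMean_add hA hD hij hj hk t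
  have h4 := startMean_le_absorbProb (G := G) (N := Measure.dirac 0) (α := α) (β := β) (j := j)
    (k := k) t
  rw [Real.dist_eq, abs_lt] at hi' ⊢
  constructor <;> linarith [hi'.1, hi'.2]

end VanishingNoise

/-! ### Graph weights and the limit as the neighborhoods shrink. -/

section Conclusion

variable {n : ℕ} {A : Fin n → Type*} [∀ i, Fintype (A i)] [∀ i, DecidableEq (A i)]
  [∀ i, MeasurableSpace (A i)] [∀ i, MeasurableSingletonClass (A i)]
  {G : Params A} {p : ℝ≥0∞} [Fact (1 ≤ p)]
  {N : ℝ → Measure (Fin n → ℝ)} [∀ δ, IsProbabilityMeasure (N δ)] {r : ℝ → ℝ}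

/-- The weight of a graph: half the product of the probabilities of the trembles that it needs. -/
def graphWeight (g : Finset (Profile A × Profile A)) : ℝ :=
  1 / 2 * ∏ e ∈ g, trembleWeight e.1 e.2

/-- The factor `1 / 2` secures strictness: with a single profile the graph is empty and the product
equals 1. -/
lemma graphWeight_mem (hn : 0 < n) [∀ i, Nonempty (A i)] {s : Profile A}
    {g : Finset (Profile A × Profile A)} (hg : g ∈ oneStepGraphs s) :
    0 < graphWeight g ∧ graphWeight g < 1 := by
  simp only [oneStepGraphs, Finset.mem_filter] at hg
  have h1 : 0 < ∏ e ∈ g, trembleWeight e.1 e.2 :=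
    Finset.prod_pos fun e he => trembleWeight_pos hn (hg.2.2 e he)
  have h2 : ∏ e ∈ g, trembleWeight e.1 e.2 ≤ 1 :=
    Finset.prod_le_one (fun e _ => trembleWeight_nonneg _ _) fun e _ => trembleWeight_le_one hn _ _
  unfold graphWeight
  constructor <;> linarith

/-- The hitting probability is caught between `q` and `q / (1 - δ) ^ (k + 2)`, with `q` the
absorption probability under the noise `N δ`. -/
lemma tendsto_hitProb (hA : Admissible G) (hG : TameAt G 0)
    (hN : ∀ᶠ δ in 𝓝[>] 0, TameNoise G (N δ) p (r δ)) (hr : ∀ δ, 0 < δ → r δ < δ)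
    (hr0 : Tendsto r (𝓝[>] 0) (𝓝 0)) {k : ℕ} (hk : 1 ≤ (k + 1) * (G.ε * G.h)) {α β : Profile A}
    (h : OneStep α β) : Tendsto (fun δ => hitProb p G (N δ) δ α β) (𝓝[>] 0)
      (𝓝 (edgeProb G (Measure.dirac 0) k α β)) := by
  have hlim := tendsto_edgeProb hA hG hN hr0 hk α β
  have hδ : Tendsto (fun δ : ℝ => (1 - δ) ^ (k + 2)) (𝓝[>] 0) (𝓝 1) := by
    have : Continuous fun δ : ℝ => (1 - δ) ^ (k + 2) := by fun_prop
    simpa using (this.tendsto 0).mono_left nhdsWithin_le_nhds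
  have hup : Tendsto (fun δ => edgeProb G (N δ) k α β / (1 - δ) ^ (k + 2)) (𝓝[>] 0)
      (𝓝 (edgeProb G (Measure.dirac 0) k α β)) := by
    have h1 := hlim.div hδ one_ne_zero
    rw [div_one] at h1
    exact h1
  obtain ⟨j, hj, hij, e⟩ := h.edgeProb_eq (G := G) (k := k)
  refine tendsto_of_tendsto_of_tendsto_of_le_of_le' hlim hup ?_ ?_
  · filter_upwards [hN, self_mem_nhdsWithin] with δ h1 h2
    rw [e]
    exact absorbProb_le_hitProb hA h1 hij hj hk (hr δ h2)
  · filter_upwards [hN, Ioo_mem_nhdsGT (zero_lt_one' ℝ)] with δ h1 h2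
    have h3 : 0 < (1 - δ) ^ (k + 2) := pow_pos (by linarith [h2.2]) _
    rw [le_div_iff₀ h3, mul_comm, e]
    exact hitProb_mul_le_absorbProb hA h1 hij hj hk h2.2.le

/-- Some tame noise value has entries of size at most `δ`, so the bounds hold without noise up to
errors of order `δ`. They survive the limit because `TameAt` uses weak inequalities. -/
lemma tameAt_zero (h : ∀ δ, 0 < δ → r δ < δ)
    (hN : ∀ᶠ δ in 𝓝[>] 0, TameNoise G (N δ) p (r δ)) (hε : 0 < G.ε) : TameAt G 0 := by
  have key : ∀ i α, ∀ᶠ δ in 𝓝[>] (0 : ℝ),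
      G.h ≤ G.u i α + δ ∧ G.ε * G.u i α ≤ 1 + G.ε * δ := by
    intro i α
    filter_upwards [hN, self_mem_nhdsWithin] with δ h1 h2
    obtain ⟨υ, h3, h4⟩ := h1.exists
    have h5 : |υ i| ≤ δ := (PiLp.norm_apply_le
      (WithLp.toLp p υ : PiLp p fun _ : Fin n => ℝ) i).trans (h4.trans (h δ h2).le)
    obtain ⟨h6, h7⟩ := abs_le.1 h5
    obtain ⟨h8, h9⟩ := h3 i α
    rw [measuredUtility] at h8 h9
    exact ⟨by linarith, by nlinarith⟩
  have hid : Tendsto (fun δ : ℝ => δ) (𝓝[>] 0) (𝓝 0) := nhdsWithin_le_nhds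
  intro i α
  simp only [measuredUtility, Pi.zero_apply, add_zero]
  constructor
  · have := hid.const_add (G.u i α)
    rw [add_zero] at this
    exact ge_of_tendsto this ((key i α).mono fun _ h => h.1)
  · have := (hid.const_mul G.ε).const_add 1
    rw [mul_zero, add_zero] at this
    exact ge_of_tendsto this ((key i α).mono fun _ h => h.2)

lemma tendsto_graphSum (hA : Admissible G) (hG : TameAt G 0)
    (hN : ∀ᶠ δ in 𝓝[>] 0, TameNoise G (N δ) p (r δ)) (hr : ∀ δ, 0 < δ → r δ < δ)
    (hr0 : Tendsto r (𝓝[>] 0) (𝓝 0)) {k : ℕ} (hk : 1 ≤ (k + 1) * (G.ε * G.h)) (s : Profile A) :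
    Tendsto (fun δ => graphSum graphWeight p G (N δ) δ s) (𝓝[>] 0)
      (𝓝 (1 / 2 * treeWeight (absorbMatrix (edgeProb G (Measure.dirac 0) k)) s)) := by
  rw [treeWeight_absorbMatrix, Finset.mul_sum]
  refine tendsto_finsetSum _ fun g hg => ?_
  rw [← mul_assoc]
  refine Tendsto.const_mul _ (tendsto_finsetProd _ fun e he => ?_)
  simp only [oneStepGraphs, Finset.mem_filter] at hg
  exact tendsto_hitProb hA hG hN hr hr0 hk (hg.2.2 e he)

lemma tendsto_treeWeight {ι V : Type*} [Fintype V] [DecidableEq V] {l : Filter ι}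
    {M : ι → V → V → ℝ} {M' : V → V → ℝ} (h : ∀ a b, Tendsto (fun i => M i a b) l (𝓝 (M' a b)))
    (s : V) : Tendsto (fun i => treeWeight (M i) s) l (𝓝 (treeWeight M' s)) :=
  tendsto_finsetSum _ fun _ _ => tendsto_finsetProd _ fun _ _ => h _ _

lemma tendsto_absorbMatrix {ι : Type*} {l : Filter ι} {q : ι → Profile A → Profile A → ℝ}
    {q' : Profile A → Profile A → ℝ} (h : ∀ a b, Tendsto (fun i => q i a b) l (𝓝 (q' a b)))
    (α γ : Profile A) : Tendsto (fun i => absorbMatrix (q i) α γ) l (𝓝 (absorbMatrix q' α γ)) := by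
  refine tendsto_finsetSum _ fun β _ => Tendsto.const_mul _ ?_
  unfold settleProb
  split_ifs
  · exact tendsto_const_nhds
  · exact tendsto_const_nhds
  · exact h _ _
  · exact (h _ _).const_sub 1
  · exact tendsto_const_nhds

end Conclusion

end APLA

end

/-! ### Assembly of the main statement. -/

theorem mainTheorem9 (n : ℕ) (hn : 0 < n) (A : Fin n → Type*)
    [∀ i, Fintype (A i)] [∀ i, Nonempty (A i)] [∀ i, DecidableEq (A i)]
    [∀ i, MeasurableSpace (A i)] [∀ i, MeasurableSingletonClass (A i)] :
    ∃ γ : Finset (APLA.Profile A × APLA.Profile A) → ℝ,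
      (∀ s, ∀ g ∈ APLA.oneStepGraphs (A := A) s, 0 < γ g ∧ γ g < 1) ∧
      ∀ (p : ℝ≥0∞) [Fact (1 ≤ p)] (G : APLA.Params A),
        0 < G.ε → 0 < G.h → 0 < G.c → 0 < G.ν → G.ε * G.ν < 1 →
      ∀ (υbar : ℝ → ℝ) (N : ℝ → Measure (Fin n → ℝ)) [∀ δ, IsProbabilityMeasure (N δ)],
        (∀ δ, 0 < δ → υbar δ < δ) →
        (∀ δ, 0 < δ → ∀ᵐ υ ∂(N δ), ‖(WithLp.toLp p υ : PiLp p fun _ : Fin n => ℝ)‖ ≤ υbar δ) →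
        (∀ᶠ δ in 𝓝[>] (0 : ℝ), ∀ᵐ υ ∂(N δ), ∀ i α,
          0 < G.ε * APLA.measuredUtility G α υ i ∧ G.ε * APLA.measuredUtility G α υ i < 1 ∧
            G.h < APLA.measuredUtility G α υ i) →
        (∀ᶠ δ in 𝓝[>] (0 : ℝ),
          (∀ s s', Tendsto (fun t : ℕ =>
              (((APLA.unperturbed G (N δ) ^ t) ∘ₖ APLA.oneTremble G (N δ))
                (APLA.pureState G s) (APLA.nhd p G δ s')).toReal)
            atTop (𝓝 (APLA.limitChain p G (N δ) δ s s'))) ∧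
          APLA.limitChain p G (N δ) δ ∈ Matrix.rowStochastic ℝ (APLA.Profile A) ∧
          ∃! π : APLA.Profile A → ℝ, APLA.IsStationary (APLA.limitChain p G (N δ) δ) π) ∧
        ∀ πhat : ℝ → APLA.Profile A → ℝ,
          (∀ᶠ δ in 𝓝[>] (0 : ℝ), APLA.IsStationary (APLA.limitChain p G (N δ) δ) (πhat δ)) →
          ∃ L : APLA.Profile A → ℝ, ∀ s,
            Tendsto (fun δ => πhat δ s) (𝓝[>] 0) (𝓝 (L s)) ∧
            Tendsto (fun δ => APLA.graphDistribution γ p G (N δ) δ s) (𝓝[>] 0) (𝓝 (L s)) := by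
  refine ⟨APLA.graphWeight, fun s g hg => APLA.graphWeight_mem hn hg, ?_⟩
  intro p _ G hε hh hc hν hεν υbar N _ hυ hυN htame
  have hA : APLA.Admissible G := ⟨hε, hh, hc, hν, hεν⟩
  have hN : ∀ᶠ δ in 𝓝[>] (0 : ℝ), APLA.TameNoise G (N δ) p (υbar δ) := by
    filter_upwards [htame, self_mem_nhdsWithin] with δ h1 h2
    filter_upwards [h1, hυN δ h2] with υ h3 h4
    exact ⟨fun i α => ⟨(h3 i α).2.2.le, (h3 i α).2.1.le⟩, h4⟩
  have hG : APLA.TameAt G 0 := APLA.tameAt_zero hυ hN hε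
  have hr0 : Tendsto υbar (𝓝[>] 0) (𝓝 0) := by
    refine tendsto_of_tendsto_of_tendsto_of_le_of_le' tendsto_const_nhds
      (nhdsWithin_le_nhds : Tendsto (fun δ : ℝ => δ) (𝓝[>] 0) (𝓝 0)) ?_ ?_
    · filter_upwards [hN] with δ h using h.radius_nonneg
    · filter_upwards [self_mem_nhdsWithin] with δ h using (hυ δ h).le
  -- The exponent depends only on `ε h`; one choice serves all `δ` and the noiseless chain.
  obtain ⟨k, hk⟩ : ∃ k : ℕ, 1 ≤ ((k : ℝ) + 1) * (G.ε * G.h) := by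
    obtain ⟨k, hk⟩ := exists_nat_gt (1 / (G.ε * G.h))
    have h0 := mul_pos hε hh
    rw [div_lt_iff₀ h0] at hk
    exact ⟨k, by nlinarith⟩
  have hchain : ∀ᶠ δ in 𝓝[>] (0 : ℝ), APLA.TameNoise G (N δ) p (υbar δ) ∧ υbar δ < δ ∧
      APLA.limitChain p G (N δ) δ = APLA.absorbMatrix (APLA.edgeProb G (N δ) k) := by
    filter_upwards [hN, self_mem_nhdsWithin] with δ h1 h2
    exact ⟨h1, hυ δ h2, APLA.limitChain_eq hn hA h1 (hυ δ h2) hk⟩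
  have hq0 : ∀ (M : Measure (Fin n → ℝ)) [IsProbabilityMeasure M], ∀ α β,
      0 ≤ APLA.edgeProb G M k α β := fun M _ => APLA.edgeProb_nonneg
  have hq1 : ∀ (M : Measure (Fin n → ℝ)) [IsProbabilityMeasure M], ∀ α β,
      APLA.edgeProb G M k α β ≤ 1 := fun M _ => APLA.edgeProb_le_one
  constructor
  · filter_upwards [hchain] with δ hδ
    obtain ⟨h1, h2, h3⟩ := hδ
    rw [h3]
    refine ⟨fun s s' => APLA.tendsto_comp_oneTremble hn hA h1 h2 hk s s', ?_, ?_⟩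
    · rw [Matrix.mem_rowStochastic_iff_sum]
      exact ⟨APLA.absorbMatrix_nonneg (hq0 _) (hq1 _), APLA.sum_absorbMatrix hn _⟩
    · refine ⟨_, (APLA.isStationary_absorbMatrix_iff hn (hq0 _) (hq1 _)
        (fun α β h => APLA.edgeProb_pos hA h1 h) _).2 rfl, fun π hπ => ?_⟩
      exact (APLA.isStationary_absorbMatrix_iff hn (hq0 _) (hq1 _)
        (fun α β h => APLA.edgeProb_pos hA h1 h) _).1 hπ
  · intro πhat hπ
    set q₀ := APLA.edgeProb G (Measure.dirac 0) k with hq₀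
    have htree := fun s => APLA.tendsto_treeWeight
      (APLA.tendsto_absorbMatrix fun α β => APLA.tendsto_edgeProb hA hG hN hr0 hk α β) s
    have hpos : ∀ s, 0 < APLA.treeWeight (APLA.absorbMatrix q₀) s :=
      APLA.treeWeight_pos hn (hq0 _) (hq1 _) fun α β h =>
        APLA.edgeProb_pos hA (APLA.tameNoise_dirac (p := p) hG) h
    have hsum : 0 < ∑ s, APLA.treeWeight (APLA.absorbMatrix q₀) s :=
      Finset.sum_pos (fun s _ => hpos s) ⟨Classical.arbitrary _, Finset.mem_univ _⟩
    refine ⟨fun s => APLA.treeWeight (APLA.absorbMatrix q₀) s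
      / ∑ s', APLA.treeWeight (APLA.absorbMatrix q₀) s', fun s => ⟨?_, ?_⟩⟩
    · refine ((htree s).div (tendsto_finsetSum _ fun s' _ => htree s') hsum.ne').congr' ?_
      filter_upwards [hchain, hπ] with δ hδ hδ'
      obtain ⟨h1, h2, h3⟩ := hδ
      rw [h3] at hδ'
      exact (congrFun ((APLA.isStationary_absorbMatrix_iff hn (hq0 _) (hq1 _)
        (fun α β h => APLA.edgeProb_pos hA h1 h) _).1 hδ') s).symm
    · have hs := fun s => APLA.tendsto_graphSum hA hG hN hυ hr0 hk s
      have h := (hs s).div (tendsto_finsetSum Finset.univ fun s' _ => hs s') (by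
        rw [← Finset.mul_sum]
        exact (mul_pos one_half_pos hsum).ne')
      -- The factor `1 / 2` in the graph weights is the same for all graphs and cancels.
      rw [← Finset.mul_sum, mul_div_mul_left _ _ (by norm_num)] at h
      exact h
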